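/- **Setting.** Let $\mathcal L_{\mathrm R}$ be a finite relational first-order language and let $M$ be an infinite strong Fraïssé limit over $\mathcal L_{\mathrm R}$, i.e. a countably infinite ultrahomogeneous $\mathcal L_{\mathrm R}$-structure whose age has the strong amalgamation property (including amalgamation over the empty structure). A meet-tree is a lower semilattice in which the set of elements strictly below any given element is a chain; the language of meet-trees consists of a binary relation symbol for the strict order $<$ and a binary function symbol for the meet $\wedge$, and is taken disjoint from $\mathcal L_{\mathrm R}$. Let $\mathbb T^M$ be the generic meet-tree expansion of $M$: the Fraïssé limit of the class of all finite structures, in the union of $\mathcal L_{\mathrm R}$ and the language of meet-trees, whose reduct to the language of meet-trees is a meet-tree and whose reduct to $\mathcal L_{\mathrm R}$ belongs to the age of $M$. Automorphisms are automorphisms of $\mathbb T^M$ in this full language. A branch of $\mathbb T^M$ is a maximal chain. A semibranch is a downwards closed chain $\Gamma$ such that for every $a\in\mathbb T^M$ there is a largest element of $\Gamma$ that is $\le a$. Write $\Gamma^\circ=\{a\in\Gamma : a<b \text{ for some } b\in\Gamma\}$. An automorphism $\alpha$ setwise fixing $\Gamma$ is unbounded in $\Gamma^\circ$ if for every $x\in\Gamma^\circ$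 there are $y,z\in\Gamma^\circ$ with $y<x<z$, $\alpha(y)\ne y$ and $\alpha(z)\neq z$; it is strictly increasing in $\Gamma^\circ$ if $\alpha(x)>x$ for all $x\in\Gamma^\circ$. The cones above a point $\gamma$ are the classes of the equivalence relation $a\wedge b>\gamma$ on $\{a : a>\gamma\}$. **Corollary.** Let $\Gamma$ be a semibranch of $\mathbb T^M$ and let $\alpha$ be an automorphism of $\mathbb T^M$ that setwise fixes $\Gamma$ and is unbounded in $\Gamma^\circ$. Then there are $\varepsilon_1,\dots,\varepsilon_4\in\{1,-1\}$ and automorphisms $\beta_1,\dots,\beta_4$ of $\mathbb T^M$ setwise fixing $\Gamma$ such that the product $$(\beta_1^{-1}\alpha^{\varepsilon_1}\beta_1)(\beta_2^{-1}\alpha^{\varepsilon_2}\beta_2)(\beta_3^{-1}\alpha^{\varepsilon_3}\beta_3)(\beta_4^{-1}\alpha^{\varepsilon_4}\beta_4)$$ is strictly increasing in $\Gamma^\circ$. Furthermore, if $\Gamma$ is not a branch, then $\Gamma$ has a maximum $\gamma$, and $\beta_1,\dots,\beta_4$ can be chosen so that in addition each of them setwise fixes every cone above $\gamma$. -/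

import Mathlib

open FirstOrder FirstOrder.Language
open CategoryTheory (Bundled)
open scoped FirstOrder

universe u v w

namespace MeetTreeExpansion

/-! ### Meet-trees -/

/-- The function symbols of the language of meet-trees: a binary symbol for the meet. -/
inductive MeetTreeFunctions : ℕ → Type
  | meet : MeetTreeFunctions 2

/-- The relation symbols of the language of meet-trees: a binary symbol for the strict order. -/
inductive MeetTreeRelations : ℕ → Type
  | lt : MeetTreeRelations 2

/-- The first-order language of meet-trees. -/
def meetTree : FirstOrder.Language.{0, 0} := ⟨MeetTreeFunctions, MeetTreeRelations⟩

/-- A lower semilattice as a structure in the language of meet-trees. -/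
instance meetTreeStructure (T : Type w) [SemilatticeInf T] : meetTree.Structure T where
  funMap := fun {_} f x => match f, x with
    | .meet, x => x 0 ⊓ x 1
  RelMap := fun {_} r x => match r, x with
    | .lt, x => x 0 < x 1

/-- A lower semilattice is a meet-tree if the elements below any given point form a chain. -/
def IsMeetTree (T : Type w) [SemilatticeInf T] : Prop :=
  ∀ a : T, IsChain (· ≤ ·) (Set.Iio a)

/-- The class of finite meet-trees, as structures in the language of meet-trees. -/
def finiteMeetTrees : Set (Bundled.{w} meetTree.Structure) :=
  {N | Finite N ∧ ∃ s : SemilatticeInf N, @IsMeetTree N s ∧ N.str = @meetTreeStructure N s}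

/-! ### Strong Fraïssé limits and mixes of classes -/

/-- The strong amalgamation property: any two extensions `N`, `P` in `K` of a structure `B` in `K`
can be amalgamated in `K` over `B` so that the images of `N` and `P` meet only in the image of `B`.
In a relational language `B` may be empty, and this case is strong joint embedding. -/
def StrongAmalgamation {L : FirstOrder.Language.{u, v}} (K : Set (Bundled.{w} L.Structure)) : Prop :=
  ∀ (B N P : Bundled.{w} L.Structure) (f : B ↪[L] N) (g : B ↪[L] P),
    B ∈ K → N ∈ K → P ∈ K →
      ∃ (Q : Bundled.{w} L.Structure) (f' : N ↪[L] Q) (g' : P ↪[L] Q),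
        Q ∈ K ∧ f'.comp f = g'.comp g ∧
          Set.range f' ∩ Set.range g' = Set.range (f'.comp f)

/-- `M` is a strong Fraïssé limit: it is the Fraïssé limit of its age, and its age has the strong
amalgamation property. -/
def IsStrongFraisseLimit (L : FirstOrder.Language.{u, v}) [Countable (Σ l, L.Functions l)]
    (M : Type w) [L.Structure M] [Countable M] : Prop :=
  IsFraisseLimit (L.age M) M ∧ StrongAmalgamation (L.age M)

/-- The mix of a class of `L₁`-structures and a class of `L₂`-structures, for disjoint languages:
the structures in the union of the languages whose reducts belong to the given classes. -/
def mix {L₁ : FirstOrder.Language.{0, 0}} {L₂ : FirstOrder.Language.{u, v}} (K₁ : Set (Bundled.{w} L₁.Structure))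
    (K₂ : Set (Bundled.{w} L₂.Structure)) : Set (Bundled.{w} (L₁.sum L₂).Structure) :=
  {N | ⟨N, (LHom.sumInl : L₁ →ᴸ L₁.sum L₂).reduct N⟩ ∈ K₁ ∧
    ⟨N, (LHom.sumInr : L₂ →ᴸ L₁.sum L₂).reduct N⟩ ∈ K₂}

instance countable_meetTreeFunctions (l : ℕ) : Countable (MeetTreeFunctions l) :=
  Function.Injective.countable (f := fun _ => (0 : ℕ)) (by
    rintro ⟨⟩ ⟨⟩ _
    rfl)

instance countable_sum_functions (L : FirstOrder.Language.{u, v}) [L.IsRelational] :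
    Countable (Σ l, (meetTree.sum L).Functions l) := by
  have (l : ℕ) : Countable ((meetTree.sum L).Functions l) :=
    inferInstanceAs (Countable (MeetTreeFunctions l ⊕ L.Functions l))
  infer_instance

/-- `T`, a lower semilattice which also carries an `L`-structure, is the generic meet-tree expansion
of the `L`-structure `M`: the Fraïssé limit of the mix of the class of finite meet-trees with the
age of `M`. -/
def IsGenericMeetTreeExpansion (L : FirstOrder.Language.{u, v}) [L.IsRelational]
    (M : Type w) [L.Structure M]
    (T : Type w) [SemilatticeInf T] [L.Structure T] [Countable T] : Prop :=
  IsFraisseLimit (L := meetTree.sum L) (mix finiteMeetTrees (L.age M)) T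

/-- Automorphisms of `T` in the union of the language of meet-trees and `L`. -/
abbrev TreeAut (L : FirstOrder.Language.{u, v}) (T : Type w)
    [SemilatticeInf T] [L.Structure T] : Type w :=
  T ≃[meetTree.sum L] T

/-- The conjugate `β⁻¹ α β`. -/
def conj {L : FirstOrder.Language.{u, v}} {T : Type w} [SemilatticeInf T] [L.Structure T]
    (β α : TreeAut L T) : TreeAut L T :=
  β.symm.comp (α.comp β)

/-! ### Semibranches and cones -/

section Order

variable {T : Type w} [SemilatticeInf T]

/-- A branch is a maximal chain. -/
def IsBranch (Γ : Set T) : Prop := IsMaxChain (· ≤ ·) Γ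

/-- A (closed) semibranch is a downwards closed chain `Γ` such that below every point there is a
largest element of `Γ`. -/
structure IsSemibranch (Γ : Set T) : Prop where
  isLowerSet : IsLowerSet Γ
  isChain : IsChain (· ≤ ·) Γ
  exists_isGreatest : ∀ a : T, ∃ b, IsGreatest {b | b ∈ Γ ∧ b ≤ a} b

/-- The set `Γ°` of elements of `Γ` that are not maximal in `Γ`. -/
def inner (Γ : Set T) : Set T := {a | a ∈ Γ ∧ ∃ b ∈ Γ, a < b}

/-- The (open) cones above `γ`: the classes of the equivalence relation `γ < a ⊓ b` on the set of
points `> γ`. -/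
def cones (γ : T) : Set (Set T) := {C | ∃ a, γ < a ∧ C = {b | γ < b ∧ γ < a ⊓ b}}

/-- `S` is upwards unbounded in `Γ°`. -/
def UpwardsUnbounded (Γ S : Set T) : Prop := ∀ x ∈ inner Γ, ∃ y ∈ S, x < y

/-- `S` is downwards unbounded in `Γ°`. -/
def DownwardsUnbounded (Γ S : Set T) : Prop := ∀ x ∈ inner Γ, ∃ y ∈ S, y < x

/-- The map `α` is unbounded in `Γ°`: the set of points of `Γ°` which are not fixed by `α` is
upwards and downwards unbounded in `Γ°`. -/
def IsUnbounded (Γ : Set T) (α : T → T) : Prop :=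
  UpwardsUnbounded Γ {x | x ∈ inner Γ ∧ α x ≠ x} ∧
    DownwardsUnbounded Γ {x | x ∈ inner Γ ∧ α x ≠ x}

/-- The map `α` is strictly increasing in `Γ°`: it is strictly increasing at every point of it. -/
def IsStrictlyIncreasing (Γ : Set T) (α : T → T) : Prop := ∀ x ∈ inner Γ, x < α x

end Order

end MeetTreeExpansion

/-! Some `g` among `α`, `α⁻¹` moves points of `Γ°` upwards arbitrarily high up, and some `h` among
them does so arbitrarily far down. A generic `β₁` makes `δ = (β₁⁻¹ h β₁) g` move points upwards in
both directions (`exists_conj_comp_movesUp`), and a generic `β₂` makes `(β₂⁻¹ δ β₂) δ` increase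
every point of `Γ°` (`exists_conj_comp_increasing`). Expanding the last product gives four
conjugates.

Both steps rest on one remark (`lt_conj_of_le`): if `v ≤ y`, `x < u` and `β u = h (β v)`, then `x <
u = β⁻¹ h β v ≤ β⁻¹ h β y`. Two values of `β` thus force an inequality, and one pair `(v, u)` serves
a whole interval of points `x`. Hence `β` can be built by back-and-forth from finite approximations,
adding such pairs on the way.

An approximation is a finite set `A` with an automorphism `σ`, of which only the values on `A`
count. `A` is closed under meets and under projection to `Γ`, and `σ` respects projections, the
maximum of `Γ` and the cones above it. To add a point `x`, replace `σ` by `g ∘ σ`, where `g` fixes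
`σ '' A` and moves `σ x` to a suitable place (`exists_relocation`). Such a `g` exists because the
tree structure and the `L`-structure are independent in the Fraïssé class: the tree position of a
new point over a finite set and its relations to the points of `σ '' A` can be prescribed
separately, and strong amalgamation keeps the new point distinct from all old ones. -/

namespace MeetTreeExpansion

variable {L : FirstOrder.Language.{u, v}} {T : Type w} [SemilatticeInf T] [L.Structure T]

/-! ### Automorphisms of the expansion -/

theorem TreeAut.map_inf (σ : TreeAut L T) (a b : T) : σ (a ⊓ b) = σ a ⊓ σ b :=
  σ.map_fun' (Sum.inl MeetTreeFunctions.meet : (meetTree.sum L).Functions 2) ![a, b]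

theorem TreeAut.map_le_iff (σ : TreeAut L T) {a b : T} : σ a ≤ σ b ↔ a ≤ b := by
  rw [← inf_eq_left, ← σ.map_inf, σ.injective.eq_iff, inf_eq_left]

theorem TreeAut.map_lt_iff (σ : TreeAut L T) {a b : T} : σ a < σ b ↔ a < b := by
  rw [lt_iff_le_not_ge, σ.map_le_iff, σ.map_le_iff, lt_iff_le_not_ge]

theorem TreeAut.map_rel (σ : TreeAut L T) {n : ℕ} (r : L.Relations n) (x : Fin n → T) :
    Structure.RelMap r (σ ∘ x) ↔ Structure.RelMap r x :=
  σ.map_rel' (Sum.inr r : (meetTree.sum L).Relations n) x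

/-- A bijection preserving meets and the relations of `L` is an automorphism. -/
def TreeAut.ofEquiv [L.IsRelational] (e : T ≃ T) (hinf : ∀ a b, e (a ⊓ b) = e a ⊓ e b)
    (hrel : ∀ {n : ℕ} (r : L.Relations n) (x : Fin n → T),
      Structure.RelMap r (e ∘ x) ↔ Structure.RelMap r x) : TreeAut L T where
  toEquiv := e
  map_fun' := by
    rintro n (f | f) x
    · cases f
      exact hinf _ _
    · exact isEmptyElim f
  map_rel' := by
    rintro n (r | r) x
    · cases r
      change e _ < e _ ↔ x 0 < x 1
      have h : ∀ a b, e a ≤ e b ↔ a ≤ b := fun a b => by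
        rw [← inf_eq_left, ← hinf, e.injective.eq_iff, inf_eq_left]
      rw [lt_iff_le_not_ge, h, h, lt_iff_le_not_ge]
    · exact hrel r x

/-- The map `φ` preserves the relations of `L` between points of `A`. -/
def PreservesRel (L : FirstOrder.Language.{u, v}) {T : Type w} [L.Structure T]
    (A : Set T) (φ : T → T) : Prop :=
  ∀ ⦃n : ℕ⦄ (r : L.Relations n) (x : Fin n → T), (∀ i, x i ∈ A) →
    (Structure.RelMap r (φ ∘ x) ↔ Structure.RelMap r x)

/-! ### Finite substructures and extensions -/

/-- A meet-closed subset as a substructure. -/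
def substructureOfInfClosed [L.IsRelational] (A : Set T) (hA : InfClosed A) :
    (meetTree.sum L).Substructure T where
  carrier := A
  fun_mem := by
    rintro n (f | f) x hx
    · cases f
      exact hA (hx 0) (hx 1)
    · exact isEmptyElim f

theorem fg_substructureOfInfClosed [L.IsRelational] {A : Set T} (hA : InfClosed A)
    (hfin : A.Finite) : (substructureOfInfClosed (L := L) A hA).FG := by
  refine Substructure.fg_def.2 ⟨A, hfin, ?_⟩
  exact Substructure.closure_eq (substructureOfInfClosed (L := L) A hA)

/-- Ultrahomogeneity for maps on finite meet-closed sets. The order needs no hypothesis of its own,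
since `a ≤ b` means `a ⊓ b = a`. -/
theorem exists_treeAut_extending [L.IsRelational]
    (hom : (meetTree.sum L).IsUltrahomogeneous T) {A : Set T} (hfin : A.Finite)
    (hA : InfClosed A) (φ : T → T) (hinj : Set.InjOn φ A)
    (hinf : ∀ a ∈ A, ∀ b ∈ A, φ (a ⊓ b) = φ a ⊓ φ b) (hrel : PreservesRel L A φ) :
    ∃ σ : TreeAut L T, ∀ a ∈ A, σ a = φ a := by
  let S := substructureOfInfClosed (L := L) A hA
  have hle : ∀ a ∈ A, ∀ b ∈ A, (φ a ≤ φ b ↔ a ≤ b) := fun a ha b hb => by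
    rw [← inf_eq_left, ← hinf a ha b hb, hinj.eq_iff (hA ha hb) ha, inf_eq_left]
  let f : S ↪[meetTree.sum L] T :=
    { toFun := fun a => φ a
      inj' := fun a b h => Subtype.ext (hinj a.2 b.2 h)
      map_fun' := by
        rintro n (f | f) x
        · cases f
          exact hinf _ (x 0).2 _ (x 1).2
        · exact isEmptyElim f
      map_rel' := by
        rintro n (r | r) x
        · cases r
          change φ _ < φ _ ↔ (x 0 : T) < x 1
          rw [lt_iff_le_not_ge, hle _ (x 0).2 _ (x 1).2, hle _ (x 1).2 _ (x 0).2,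
            lt_iff_le_not_ge]
        · exact hrel r (fun i => (x i : T)) fun i => (x i).2 }
  obtain ⟨g, hg⟩ := hom S (fg_substructureOfInfClosed hA hfin) f
  exact ⟨g, fun a ha => (DFunLike.congr_fun hg (⟨a, ha⟩ : S)).symm⟩

variable {M : Type w} [L.Structure M]

/-- A failure would involve three points, and these generate a finite substructure, which lies in
the class. -/
theorem IsGenericMeetTreeExpansion.isMeetTree [L.IsRelational] [Countable T]
    (hT : IsGenericMeetTreeExpansion L M T) : IsMeetTree T := by
  intro a x hx y hy hxy
  have hfin : (infClosure ({x, y, a} : Set T)).Finite := (Set.toFinite _).infClosure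
  let S := substructureOfInfClosed (L := L) _ (infClosed_infClosure (s := ({x, y, a} : Set T)))
  have hS : (Bundled.mk S inferInstance : Bundled (meetTree.sum L).Structure) ∈
      mix finiteMeetTrees (L.age M) := by
    rw [← hT.age]
    exact age.fg_substructure (fg_substructureOfInfClosed _ hfin)
  obtain ⟨⟨-, s, hs, hstr⟩, -⟩ := hS
  have hlt : ∀ p q : S, (p : T) < q ↔ s.lt p q := fun p q => by
    have := congrArg (fun st : meetTree.Structure S => st.RelMap MeetTreeRelations.lt ![p, q]) hstr
    exact iff_of_eq this
  have sub : ({x, y, a} : Set T) ⊆ infClosure ({x, y, a} : Set T) := subset_infClosure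
  let x' : S := ⟨x, sub (by simp)⟩
  let y' : S := ⟨y, sub (by simp)⟩
  let a' : S := ⟨a, sub (by simp)⟩
  have h1 : s.lt x' a' := (hlt x' a').1 hx
  have h2 : s.lt y' a' := (hlt y' a').1 hy
  have hne : x' ≠ y' := fun h => hxy (congrArg Subtype.val h)
  have key : ∀ p q : S, s.le p q → p ≠ q → (p : T) ≤ q := fun p q h hpq =>
    ((hlt p q).2 (@lt_of_le_of_ne S s.toPartialOrder _ _ h hpq)).le
  rcases hs a' h1 h2 hne with h | h
  · exact Or.inl (key x' y' h hne)
  · exact Or.inr (key y' x' h hne.symm)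

/-- A subset of a structure in a relational language, as a substructure. -/
def relSubstructure (L : FirstOrder.Language.{u, v}) [L.IsRelational] {N : Type w} [L.Structure N]
    (A : Set N) : L.Substructure N where
  carrier := A
  fun_mem := fun f => isEmptyElim f

theorem IsGenericMeetTreeExpansion.relSubstructure_mem_age [L.IsRelational] [Countable T]
    (hT : IsGenericMeetTreeExpansion L M T) {A : Set T} (hA : A.Finite) :
    (Bundled.mk (relSubstructure L A) inferInstance : Bundled L.Structure) ∈ L.age M := by
  have hfin : (infClosure A).Finite := hA.infClosure
  let S := substructureOfInfClosed (L := L) _ (infClosed_infClosure (s := A))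
  have hS : (Bundled.mk S inferInstance : Bundled (meetTree.sum L).Structure) ∈
      mix finiteMeetTrees (L.age M) := by
    rw [← hT.age]
    exact age.fg_substructure (fg_substructureOfInfClosed _ hfin)
  let : L.Structure S := (LHom.sumInr : L →ᴸ meetTree.sum L).reduct S
  obtain ⟨-, -, ⟨f⟩⟩ := hS
  change S ↪[L] M at f
  have : Finite (relSubstructure L A) := hA
  refine ⟨⟨⟨Set.finite_univ.toFinset, ?_⟩⟩, ⟨?_⟩⟩
  · rw [Set.Finite.coe_toFinset]
    exact Substructure.closure_univ
  · exact
      { toFun := fun a => f ⟨a.1, subset_infClosure a.2⟩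
        inj' := fun a b h => Subtype.ext (congrArg (fun s : S => (s : T)) (f.injective h))
        map_fun' := fun g => isEmptyElim g
        map_rel' := fun r x => f.map_rel' r fun i => ⟨(x i).1, subset_infClosure (x i).2⟩ }

/-- The strong amalgam over `B` of `E` and `insert y B`, as a subset of `M`. -/
theorem exists_amalgam [L.IsRelational] [Countable T] [Countable M]
    (hM : IsStrongFraisseLimit L M) (hT : IsGenericMeetTreeExpansion L M T)
    {E B : Set T} (hE : E.Finite) (hBE : B ⊆ E) {y : T} (hy : y ∉ B) :
    ∃ φ : Option E → M, Function.Injective φ ∧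
      (∀ {n : ℕ} (r : L.Relations n) (x : Fin n → E),
        Structure.RelMap r (fun i => φ (some (x i))) ↔ Structure.RelMap r fun i => (x i : T)) ∧
      ∀ {n : ℕ} (r : L.Relations n) (x : Fin n → Option E),
        (∀ i, ∀ e ∈ x i, (e : T) ∈ B) →
        (Structure.RelMap r (fun i => φ (x i)) ↔
          Structure.RelMap r fun i => (x i).elim y Subtype.val) := by
  have hB : B.Finite := hE.subset hBE
  let f : relSubstructure L B ↪[L] relSubstructure L E :=
    { toFun := fun a => ⟨a.1, hBE a.2⟩
      inj' := fun a b h => Subtype.ext (congrArg (fun s : relSubstructure L E => (s : T)) h)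
      map_fun' := fun g => isEmptyElim g
      map_rel' := fun r x => Iff.rfl }
  let g : relSubstructure L B ↪[L] relSubstructure L (insert y B) :=
    { toFun := fun a => ⟨a.1, Or.inr a.2⟩
      inj' := fun a b h =>
        Subtype.ext (congrArg (fun s : relSubstructure L (insert y B) => (s : T)) h)
      map_fun' := fun g => isEmptyElim g
      map_rel' := fun r x => Iff.rfl }
  obtain ⟨Q, f', g', hQ, hcomp, hrange⟩ := hM.2 ⟨relSubstructure L B, inferInstance⟩
    ⟨relSubstructure L E, inferInstance⟩ ⟨relSubstructure L (insert y B), inferInstance⟩ f g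
    (hT.relSubstructure_mem_age hB) (hT.relSubstructure_mem_age hE)
    (hT.relSubstructure_mem_age (hB.insert y))
  obtain ⟨-, ⟨q⟩⟩ := hQ
  let y₀ : relSubstructure L (insert y B) := ⟨y, Or.inl rfl⟩
  -- Strong amalgamation is needed here: `y` may itself lie in `E \ B`, but its copy in `Q` is kept
  -- apart from that of `E`.
  have hy₀ : g' y₀ ∉ Set.range f' := by
    intro h
    have : g' y₀ ∈ Set.range (f'.comp f) := hrange ▸ ⟨h, y₀, rfl⟩
    obtain ⟨b, hb⟩ := this
    rw [hcomp] at hb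
    have := congrArg (fun s : relSubstructure L (insert y B) => (s : T)) (g'.injective hb)
    exact hy ((show (b : T) = y from this) ▸ b.2)
  let ψ : Option E → Q := fun o => o.elim (g' y₀) fun e => f' e
  have hψ : Function.Injective ψ := by
    rintro (_ | a) (_ | b) h
    · rfl
    · exact absurd ⟨b, h.symm⟩ hy₀
    · exact absurd ⟨a, h⟩ hy₀
    · exact congrArg some (f'.injective h)
  refine ⟨q ∘ ψ, q.injective.comp hψ, fun r x => ?_, fun {n} r x hx => ?_⟩
  · exact (q.map_rel' r _).trans (f'.map_rel' r x)
  · have hmem : ∀ o : Option E, (∀ e ∈ o, (e : T) ∈ B) → o.elim y Subtype.val ∈ insert y B := by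
      rintro (_ | e) he
      · exact Or.inl rfl
      · exact Or.inr (he e rfl)
    let z : Fin n → relSubstructure L (insert y B) := fun i => ⟨_, hmem _ (hx i)⟩
    have hz : ∀ i, ψ (x i) = g' (z i) := by
      intro i
      have : ∀ (o : Option E) (ho : ∀ e ∈ o, (e : T) ∈ B), ψ o = g' ⟨_, hmem o ho⟩ := by
        rintro (_ | e) ho
        · rfl
        · exact DFunLike.congr_fun hcomp (⟨e.1, ho e rfl⟩ : relSubstructure L B)
      exact this _ (hx i)
    have : (fun i => (q ∘ ψ) (x i)) = q ∘ g' ∘ z := funext fun i => congrArg q (hz i)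
    rw [this]
    exact (q.map_rel' r _).trans (g'.map_rel' r z)

/-- If the meet-closed set `E` is extended by a new point to an abstract meet-tree, then this point
can be realized, with the relations to points of `B ⊆ E` the same as those of a given point. -/
theorem exists_realization [L.IsRelational] [Countable T] [Countable M]
    (hM : IsStrongFraisseLimit L M) (hT : IsGenericMeetTreeExpansion L M T)
    {E B : Set T} (hE : E.Finite) (hEinf : InfClosed E) (hBE : B ⊆ E) {y : T} (hy : y ∉ B)
    (s : SemilatticeInf (Option E)) (hs : IsMeetTree (Option E))
    (hinf : ∀ a b : E, s.inf (some a) (some b) = some ⟨a.1 ⊓ b.1, hEinf a.2 b.2⟩) :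
    ∃ y' ∉ E, (∀ e : E, s.inf (some e) none = none ∧ e.1 ⊓ y' = y' ∨
        ∃ c : E, s.inf (some e) none = some c ∧ e.1 ⊓ y' = c) ∧
      ∀ {n : ℕ} (r : L.Relations n) (x : Fin n → Option E),
        (∀ i, ∀ e ∈ x i, (e : T) ∈ B) →
        (Structure.RelMap r (fun i => (x i).elim y' Subtype.val) ↔
          Structure.RelMap r fun i => (x i).elim y Subtype.val) := by
  obtain ⟨φ, hφ, hφE, hφB⟩ := exists_amalgam hM hT hE hBE hy
  -- Relations are pulled back from `M`, so this reduct is in the age of `M` whatever tree structure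
  -- `s` is put on `Option E`.
  let : L.Structure (Option E) :=
    { funMap := fun f => isEmptyElim f
      RelMap := fun r x => Structure.RelMap r (φ ∘ x) }
  have : Finite E := hE
  have hN : (Bundled.mk (Option E) inferInstance : Bundled (meetTree.sum L).Structure) ∈
      (meetTree.sum L).age T := by
    rw [hT.age]
    refine ⟨⟨inferInstanceAs (Finite (Option E)), s, hs, ?_⟩, ?_⟩
    · rfl
    · have : Structure.FG L (Option E) := by
        refine ⟨⟨Set.finite_univ.toFinset, ?_⟩⟩
        rw [Set.Finite.coe_toFinset]
        exact Substructure.closure_univ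
      exact ⟨this, ⟨{ toFun := φ, inj' := hφ, map_fun' := fun g => isEmptyElim g
                      map_rel' := fun r x => Iff.rfl }⟩⟩
  obtain ⟨-, ⟨j⟩⟩ := hN
  have jinf : ∀ a b : Option E, j (s.inf a b) = j a ⊓ j b := fun a b =>
    j.map_fun' (Sum.inl MeetTreeFunctions.meet : (meetTree.sum L).Functions 2) ![a, b]
  have jrel : ∀ {n : ℕ} (r : L.Relations n) (x : Fin n → Option E),
      Structure.RelMap r (j ∘ x) ↔ Structure.RelMap r (φ ∘ x) := fun r x =>
    j.map_rel' (Sum.inr r : (meetTree.sum L).Relations _) x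
  classical
  -- Some automorphism agrees with `j` on `E`; its inverse carries `j none` to the required point.
  obtain ⟨σ, hσ⟩ := exists_treeAut_extending hT.ultrahomogeneous hE hEinf
    (fun t => if h : t ∈ E then j (some ⟨t, h⟩) else t)
    (fun a ha b hb h => by
      replace h := (dif_pos ha).symm.trans (h.trans (dif_pos hb))
      exact congrArg Subtype.val (Option.some_injective _ (j.injective h)))
    (fun a ha b hb => by
      simp only [dif_pos ha, dif_pos hb, dif_pos (hEinf ha hb), ← jinf]
      exact congrArg j (hinf ⟨a, ha⟩ ⟨b, hb⟩).symm)
    (fun n r x hx => by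
      have : ((fun t => if h : t ∈ E then j (some ⟨t, h⟩) else t) ∘ x) =
          j ∘ fun i => some (⟨x i, hx i⟩ : E) := by
        funext i
        exact dif_pos (hx i)
      rw [this, jrel]
      exact hφE r fun i => ⟨x i, hx i⟩)
  have hσ' : ∀ e : E, σ e = j (some e) := fun e => (hσ e e.2).trans (dif_pos e.2)
  have hσy : σ (σ.symm (j none)) = j none := σ.apply_symm_apply _
  refine ⟨σ.symm (j none), ?_, ?_, ?_⟩
  · intro h
    have h1 := hσ' ⟨_, h⟩
    rw [hσy] at h1
    exact absurd (j.injective h1) (by simp)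
  · intro e
    have h1 : σ (e.1 ⊓ σ.symm (j none)) = j (s.inf (some e) none) := by
      rw [σ.map_inf, hσy, hσ' e, jinf]
    rcases h : s.inf (some e) none with _ | c
    · refine Or.inl ⟨rfl, σ.injective ?_⟩
      rw [h1, h, hσy]
    · refine Or.inr ⟨c, rfl, σ.injective ?_⟩
      rw [h1, h, hσ' c]
  · intro n r x hx
    rw [← hφB r x hx, ← σ.map_rel, ← Function.comp_def φ x, ← jrel]
    have : (σ ∘ fun i => (x i).elim (σ.symm (j none)) Subtype.val) = j ∘ x := by
      funext i
      simp only [Function.comp_apply]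
      rcases x i with _ | e
      · exact hσy
      · exact hσ' e
    rw [this]

/-! ### One-point extensions of finite meet-trees -/

theorem isMeetTree_of_le {E : Type w} [SemilatticeInf E]
    (h : ∀ a x y : E, x ≤ a → y ≤ a → x ≤ y ∨ y ≤ x) : IsMeetTree E :=
  fun a x hx y hy _ => h a x y hx.le hy.le

theorem IsMeetTree.le_total {E : Type w} [SemilatticeInf E] (hE : IsMeetTree E) {a x y : E}
    (hx : x ≤ a) (hy : y ≤ a) : x ≤ y ∨ y ≤ x := by
  rcases eq_or_lt_of_le hx with rfl | hx
  · exact Or.inr hy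
  rcases eq_or_lt_of_le hy with rfl | hy
  · exact Or.inl hx.le
  exact (hE a).total hx hy

open Classical in
/-- The meet on the extension of `E` by a new point, which is covered by `e` if `p` holds, and
is a maximal point covering `e` otherwise. -/
noncomputable def onePointInf {E : Type w} [SemilatticeInf E] (p : Prop) (e : E) :
    Option E → Option E → Option E
  | some a, some b => some (a ⊓ b)
  | some a, none => if p ∧ e ≤ a then none else some (a ⊓ e)
  | none, some a => if p ∧ e ≤ a then none else some (a ⊓ e)
  | none, none => none

/-- The extension of a meet-semilattice by a new point, which is covered by `e` if `p` holds, and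
is a maximal point covering `e` otherwise. -/
@[reducible]
noncomputable def onePointExtension {E : Type w} [SemilatticeInf E] (p : Prop) (e : E) :
    SemilatticeInf (Option E) :=
  @SemilatticeInf.mk' (Option E) ⟨onePointInf p e⟩
    (by
      rintro (_ | a) (_ | b)
      · rfl
      · rfl
      · rfl
      · exact congrArg some (inf_comm _ _))
    (by
      change ∀ a b c, onePointInf p e (onePointInf p e a b) c =
        onePointInf p e a (onePointInf p e b c)
      -- `U` is the set of old points above the new one. Associativity uses only that all of them
      -- lie above `e` and that `a ⊓ b` is in `U` exactly when `a` and `b` are.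
      obtain ⟨U, hU⟩ : ∃ U : E → Prop, ∀ a, U a ↔ p ∧ e ≤ a := ⟨_, fun _ => Iff.rfl⟩
      have ss : ∀ a b, onePointInf p e (some a) (some b) = some (a ⊓ b) := fun _ _ => rfl
      have nn : onePointInf p e none none = none := rfl
      have sn : ∀ a, U a → onePointInf p e (some a) none = none := fun a h => if_pos ((hU a).1 h)
      have ns : ∀ a, U a → onePointInf p e none (some a) = none := fun a h => if_pos ((hU a).1 h)
      have sn' : ∀ a, ¬ U a → onePointInf p e (some a) none = some (a ⊓ e) :=
        fun a h => if_neg (mt (hU a).2 h)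
      have ns' : ∀ a, ¬ U a → onePointInf p e none (some a) = some (a ⊓ e) :=
        fun a h => if_neg (mt (hU a).2 h)
      have h₁ : ∀ a b : E, U b → a ⊓ e = a ⊓ e ⊓ b := fun a b h =>
        (inf_eq_left.2 (inf_le_right.trans ((hU b).1 h).2)).symm
      have h₂ : ∀ a b : E, U (a ⊓ b) ↔ U a ∧ U b := fun a b => by
        rw [hU, hU, hU, le_inf_iff]
        tauto
      rintro (_ | a) (_ | b) (_ | c)
      · rfl
      · by_cases hc : U c <;> simp [nn, ns, ns', h₂, hc]
      · by_cases hb : U b <;> simp [ns, ns', sn, sn', nn, h₂, hb]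
      · by_cases hb : U b <;> by_cases hc : U c <;> simp [ns, ns', ss, h₂, hb, hc]
        · rw [inf_comm b, inf_right_comm, ← h₁ _ _ hb]
        · rw [inf_right_comm, inf_assoc, inf_comm b]
        · rw [inf_right_comm]
      · by_cases ha : U a <;> simp [sn, sn', nn, h₂, ha]
      · by_cases ha : U a <;> by_cases hc : U c <;> simp [sn, sn', ns, ns', ss, ha, hc]
        · exact inf_le_right.trans ((hU a).1 ha).2
        · exact inf_le_right.trans ((hU c).1 hc).2
        · rw [inf_assoc, inf_comm e]
      · by_cases ha : U a <;> by_cases hb : U b <;> simp [sn, sn', ss, h₂, ha, hb]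
        · rw [inf_assoc, inf_comm a, ← h₁ _ _ ha]
        · rw [inf_right_comm, ← h₁ _ _ hb]
        · rw [inf_assoc]
      · exact congrArg some (inf_assoc _ _ _))
    (by
      rintro (_ | a)
      · rfl
      · exact congrArg some (inf_idem _))

theorem isMeetTree_onePointExtension {E : Type w} [SemilatticeInf E] (hE : IsMeetTree E)
    (p : Prop) (e : E) : @IsMeetTree (Option E) (onePointExtension p e) := by
  refine @isMeetTree_of_le _ (onePointExtension p e) ?_
  have hle : ∀ a b : Option E, (onePointExtension p e).le a b ↔ onePointInf p e a b = a :=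
    fun a b => (@inf_eq_left _ (onePointExtension p e) a b).symm
  have hss : ∀ a b : E, (onePointExtension p e).le (some a) (some b) ↔ a ≤ b := fun a b => by
    rw [hle, ← inf_eq_left]
    exact Option.some_inj
  have hsn : ∀ a : E, (onePointExtension p e).le (some a) none ↔ ¬ (p ∧ e ≤ a) ∧ a ≤ e :=
    fun a => by
      rw [hle, onePointInf]
      split_ifs with h <;> simp [h]
  have hns : ∀ a : E, (onePointExtension p e).le none (some a) ↔ p ∧ e ≤ a := fun a => by
    rw [hle, onePointInf]
    split_ifs with h <;> simp [h]
  have main : ∀ a y : E, p ∧ e ≤ a → y ≤ a → (p ∧ e ≤ y) ∨ ¬ (p ∧ e ≤ y) ∧ y ≤ e := by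
    intro a y ha hy
    by_cases h : e ≤ y
    · exact Or.inl ⟨ha.1, h⟩
    · exact Or.inr ⟨fun h' => h h'.2, (hE.le_total ha.2 hy).resolve_left h⟩
  rintro (_ | a) (_ | x) (_ | y) hx hy
  · exact Or.inl hx
  · exact Or.inr hy
  · exact Or.inl hx
  · exact (hE.le_total ((hsn x).1 hx).2 ((hsn y).1 hy).2).imp (hss x y).2 (hss y x).2
  · exact Or.inl ((onePointExtension p e).le_refl none)
  · exact (main a y ((hns a).1 hx) ((hss y a).1 hy)).imp (hns y).2 (hsn y).2
  · exact ((main a x ((hns a).1 hy) ((hss x a).1 hx)).imp (hns x).2 (hsn x).2).symm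
  · exact (hE.le_total ((hss x a).1 hx) ((hss y a).1 hy)).imp (hss x y).2 (hss y x).2

/-- Let `B` be a finite meet-closed set. A point `y ∉ B` can be moved over `B` to a point which has
a prescribed generic position over a finite set `E`. -/
theorem exists_relocation [L.IsRelational] [Countable T] [Countable M]
    (hM : IsStrongFraisseLimit L M) (hT : IsGenericMeetTreeExpansion L M T)
    {E B : Set T} (hE : E.Finite) (hB : B.Finite) (hBinf : InfClosed B) {y : T} (hy : y ∉ B)
    (p : Prop) {e : T} (he : e ∈ E)
    (hcompat : ∀ b ∈ B, (p ∧ e ≤ b) ∧ y ≤ b ∨ ¬ (p ∧ e ≤ b) ∧ b ⊓ y = b ⊓ e ∧ b ⊓ y ∈ B) :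
    ∃ h : TreeAut L T, (∀ b ∈ B, h b = b) ∧ h y ∉ E ∧
      ∀ c ∈ E, (p ∧ e ≤ c → h y ≤ c) ∧ (¬ (p ∧ e ≤ c) → c ⊓ h y = c ⊓ e) := by
  classical
  let E' := infClosure (E ∪ B)
  have hEE' : E ⊆ E' := Set.subset_union_left.trans subset_infClosure
  have hBE' : B ⊆ E' := Set.subset_union_right.trans subset_infClosure
  have hE'inf : InfClosed E' := infClosed_infClosure
  let : SemilatticeInf E' := Subtype.semilatticeInf fun _ _ ha hb => hE'inf ha hb
  have hE'tree : IsMeetTree E' := isMeetTree_of_le fun a x y hx hy =>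
    IsMeetTree.le_total (E := T) hT.isMeetTree (a := a.1) hx hy
  let e' : E' := ⟨e, hEE' he⟩
  obtain ⟨y', hy'E, hy'inf, hy'rel⟩ := exists_realization hM hT (hE.union hB).infClosure hE'inf
    hBE' hy (onePointExtension p e') (isMeetTree_onePointExtension hE'tree p e') fun a b => rfl
  have pos : ∀ c ∈ E', (p ∧ e ≤ c → c ⊓ y' = y') ∧ (¬ (p ∧ e ≤ c) → c ⊓ y' = c ⊓ e) := by
    intro c hc
    constructor
    · intro h
      have h1 : onePointInf p e' (some ⟨c, hc⟩) none = none := if_pos h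
      rcases hy'inf ⟨c, hc⟩ with h2 | ⟨d, h2, -⟩
      · exact h2.2
      · exact absurd (h2.symm.trans h1) (by simp)
    · intro h
      have h1 : onePointInf p e' (some ⟨c, hc⟩) none = some (⟨c, hc⟩ ⊓ e') := if_neg h
      rcases hy'inf ⟨c, hc⟩ with h2 | ⟨d, h2, h3⟩
      · exact absurd (h2.1.symm.trans h1) (by simp)
      · rw [h3, Option.some_injective _ (h2.symm.trans h1)]
        rfl
  have hne : ∀ b ∈ B, b ≠ y := fun b hb h => hy (h ▸ hb)
  have hne' : ∀ b ∈ B, b ≠ y' := fun b hb h => hy'E (h ▸ hBE' hb)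
  have upd : ∀ b ∈ B, Function.update id y y' b = b := fun b hb =>
    Function.update_of_ne (hne b hb) _ _
  have updy : Function.update id y y' y = y' := Function.update_self _ _ _
  have hinf : ∀ b ∈ B, Function.update id y y' (b ⊓ y) = b ⊓ y' ∧ b ⊓ y ∈ insert y B := by
    intro b hb
    rcases hcompat b hb with ⟨h1, h2⟩ | ⟨h1, h2, h3⟩
    · rw [inf_eq_right.2 h2, updy, (pos b (hBE' hb)).1 h1]
      exact ⟨rfl, Or.inl rfl⟩
    · rw [upd _ h3, h2, (pos b (hBE' hb)).2 h1]
      exact ⟨rfl, Or.inr (h2 ▸ h3)⟩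
  -- Fixing `B` and sending `y` to `y'` is a partial isomorphism: meets agree by `hcompat`,
  -- relations by the choice of `y'`.
  obtain ⟨h, hh⟩ := exists_treeAut_extending (L := L) hT.ultrahomogeneous (hB.insert y)
    (by
      rintro a (rfl | ha) b (rfl | hb)
      · exact Or.inl (inf_idem _)
      · rw [inf_comm]
        exact (hinf b hb).2
      · exact (hinf a ha).2
      · exact Or.inr (hBinf ha hb))
    (Function.update id y y')
    (by
      rintro a (rfl | ha) b (rfl | hb) hab
      · rfl
      · rw [updy, upd b hb] at hab
        exact absurd hab.symm (hne' b hb)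
      · rw [updy, upd a ha] at hab
        exact absurd hab (hne' a ha)
      · rwa [upd a ha, upd b hb] at hab)
    (by
      rintro a (rfl | ha) b (rfl | hb)
      · rw [inf_idem, inf_idem]
      · rw [inf_comm, (hinf b hb).1, updy, upd b hb, inf_comm]
      · rw [(hinf a ha).1, updy, upd a ha]
      · rw [upd a ha, upd b hb, upd _ (hBinf ha hb)])
    (by
      intro n r x hx
      have hmem : ∀ i, x i ≠ y → x i ∈ B := fun i hi => (hx i).resolve_left hi
      have key := hy'rel r
        (fun i => if hi : x i = y then none else some ⟨x i, hBE' (hmem i hi)⟩) (by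
          intro i c hc
          by_cases hi : x i = y
          · simp [hi] at hc
          · simp only [hi, dite_false, Option.mem_def, Option.some.injEq] at hc
            exact hc ▸ hmem i hi)
      convert! key using 2
      · funext i
        by_cases hi : x i = y
        · simp [hi]
        · simp [hi]
      · funext i
        by_cases hi : x i = y
        · simp [hi]
        · simp [hi])
  have hhy : h y = y' := (hh y (Or.inl rfl)).trans updy
  refine ⟨h, fun b hb => (hh b (Or.inr hb)).trans (upd b hb), ?_, fun c hc => ?_⟩
  · rw [hhy]
    exact fun h => hy'E (hEE' h)
  · rw [hhy]
    exact ⟨fun h => inf_eq_right.1 ((pos c (hEE' hc)).1 h), (pos c (hEE' hc)).2⟩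

/-! ### Finite chains, and transitivity of the cone relation -/

theorem exists_greatest_of_finite {S : Set T} (hS : S.Finite) (hne : S.Nonempty)
    (htot : ∀ a ∈ S, ∀ b ∈ S, a ≤ b ∨ b ≤ a) : ∃ m ∈ S, ∀ a ∈ S, a ≤ m := by
  obtain ⟨m, hm⟩ := hS.exists_maximal hne
  exact ⟨m, hm.1, fun a ha => (htot a ha m hm.1).elim id fun h => hm.2 ha h⟩

theorem exists_least_of_finite {S : Set T} (hS : S.Finite) (hne : S.Nonempty)
    (htot : ∀ a ∈ S, ∀ b ∈ S, a ≤ b ∨ b ≤ a) : ∃ m ∈ S, ∀ a ∈ S, m ≤ a := by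
  obtain ⟨m, hm⟩ := hS.exists_minimal hne
  exact ⟨m, hm.1, fun a ha => (htot m hm.1 a ha).elim id fun h => hm.2 ha h⟩

/-- Both meets lie below `y`, hence are comparable, and the smaller one is below `x ⊓ z`. -/
theorem IsMeetTree.lt_inf_trans (hT : IsMeetTree T) {c x y z : T} (h₁ : c < x ⊓ y)
    (h₂ : c < y ⊓ z) : c < x ⊓ z := by
  rcases hT.le_total (inf_le_right : x ⊓ y ≤ y) (inf_le_left : y ⊓ z ≤ y) with h | h
  · exact h₁.trans_le (le_inf inf_le_left (h.trans inf_le_right))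
  · exact h₂.trans_le (le_inf (h.trans inf_le_left) inf_le_right)

/-! ### The projection to a semibranch -/

namespace IsSemibranch

variable {Γ : Set T} (hΓ : IsSemibranch Γ)

include hΓ

theorem le_total {a b : T} (ha : a ∈ Γ) (hb : b ∈ Γ) : a ≤ b ∨ b ≤ a :=
  hΓ.isChain.total ha hb

theorem lt_or_le {a b : T} (ha : a ∈ Γ) (hb : b ∈ Γ) : a < b ∨ b ≤ a := by
  rcases hΓ.le_total ha hb with h | h
  · exact (eq_or_lt_of_le h).symm.imp_right fun h => h.ge
  · exact Or.inr h

/-- The largest element of the semibranch below a point. -/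
noncomputable def proj (a : T) : T := (hΓ.exists_isGreatest a).choose

theorem proj_mem (a : T) : hΓ.proj a ∈ Γ := (hΓ.exists_isGreatest a).choose_spec.1.1

theorem proj_le (a : T) : hΓ.proj a ≤ a := (hΓ.exists_isGreatest a).choose_spec.1.2

theorem le_proj {a b : T} (hb : b ∈ Γ) (h : b ≤ a) : b ≤ hΓ.proj a :=
  (hΓ.exists_isGreatest a).choose_spec.2 ⟨hb, h⟩

theorem proj_eq {a b : T} (hb : b ∈ Γ) (h : b ≤ a) (h' : ∀ c ∈ Γ, c ≤ a → c ≤ b) :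
    hΓ.proj a = b :=
  le_antisymm (h' _ (hΓ.proj_mem a) (hΓ.proj_le a)) (hΓ.le_proj hb h)

theorem proj_of_mem {a : T} (ha : a ∈ Γ) : hΓ.proj a = a :=
  hΓ.proj_eq ha le_rfl fun _ _ h => h

theorem proj_eq_self_iff {a : T} : hΓ.proj a = a ↔ a ∈ Γ :=
  ⟨fun h => h ▸ hΓ.proj_mem a, hΓ.proj_of_mem⟩

theorem proj_eq_proj {a b : T} (hab : a ≤ b) (h : hΓ.proj b ≤ a) : hΓ.proj b = hΓ.proj a :=
  le_antisymm (hΓ.le_proj (hΓ.proj_mem b) h)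
    (hΓ.le_proj (hΓ.proj_mem a) ((hΓ.proj_le a).trans hab))

theorem inf_eq_proj_inf (a : T) {p : T} (hp : p ∈ Γ) : a ⊓ p = hΓ.proj a ⊓ p :=
  le_antisymm (le_inf (hΓ.le_proj (hΓ.isLowerSet inf_le_right hp) inf_le_left) inf_le_right)
    (inf_le_inf_right p (hΓ.proj_le a))

end IsSemibranch

/-! ### Finite partial automorphisms -/

/-- The restriction of `σ` to the finite set `A` is a finite partial automorphism which respects
`Γ` and the cones above the maximum of `Γ`, if it exists. -/
structure IsPartialAut {Γ : Set T} (hΓ : IsSemibranch Γ) (A : Set T) (σ : TreeAut L T) : Prop where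
  finite : A.Finite
  infClosed : InfClosed A
  proj_mem : ∀ a ∈ A, hΓ.proj a ∈ A
  map_proj : ∀ a ∈ A, σ (hΓ.proj a) = hΓ.proj (σ a)
  max_mem : ∀ c, IsGreatest Γ c → c ∈ A
  map_max : ∀ c, IsGreatest Γ c → σ c = c
  lt_inf_map : ∀ c, IsGreatest Γ c → ∀ a ∈ A, c < a → c < a ⊓ σ a

namespace IsPartialAut

variable {Γ : Set T} {hΓ : IsSemibranch Γ} {A : Set T} {σ : TreeAut L T}

theorem map_mem_iff (h : IsPartialAut hΓ A σ) {a : T} (ha : a ∈ A) : σ a ∈ Γ ↔ a ∈ Γ := by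
  rw [← hΓ.proj_eq_self_iff, ← h.map_proj a ha, σ.injective.eq_iff, hΓ.proj_eq_self_iff]

/-- All conditions are symmetric, so extending the range reduces to extending the domain. -/
theorem symm (h : IsPartialAut hΓ A σ) : IsPartialAut hΓ (σ '' A) σ.symm where
  finite := h.finite.image σ
  infClosed := by
    rintro _ ⟨a, ha, rfl⟩ _ ⟨b, hb, rfl⟩
    exact ⟨a ⊓ b, h.infClosed ha hb, σ.map_inf a b⟩
  proj_mem := by
    rintro _ ⟨a, ha, rfl⟩
    exact ⟨_, h.proj_mem a ha, h.map_proj a ha⟩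
  map_proj := by
    rintro _ ⟨a, ha, rfl⟩
    rw [← h.map_proj a ha, σ.symm_apply_apply, σ.symm_apply_apply]
  max_mem := fun c hc => ⟨c, h.max_mem c hc, h.map_max c hc⟩
  map_max := fun c hc => by
    conv_lhs => rw [← h.map_max c hc]
    exact σ.symm_apply_apply c
  lt_inf_map := by
    rintro c hc _ ⟨a, ha, rfl⟩ hca
    rw [σ.symm_apply_apply, inf_comm]
    refine h.lt_inf_map c hc a ha ?_
    rwa [← h.map_max c hc, σ.map_lt_iff] at hca

theorem extend (h : IsPartialAut hΓ A σ) {σ' : TreeAut L T} (hσ : ∀ a ∈ A, σ' a = σ a) {x : T}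
    (hinf : ∀ a ∈ A, a ⊓ x ∈ insert x A) (hproj : hΓ.proj x ∈ insert x A)
    (hmap : σ' (hΓ.proj x) = hΓ.proj (σ' x))
    (hlt : ∀ c, IsGreatest Γ c → c < x → c < x ⊓ σ' x) : IsPartialAut hΓ (insert x A) σ' where
  finite := h.finite.insert x
  infClosed := by
    rintro a (rfl | ha) b (rfl | hb)
    · exact Or.inl (inf_idem _)
    · rw [inf_comm]
      exact hinf b hb
    · exact hinf a ha
    · exact Or.inr (h.infClosed ha hb)
  proj_mem := by
    rintro a (rfl | ha)
    · exact hproj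
    · exact Or.inr (h.proj_mem a ha)
  map_proj := by
    rintro a (rfl | ha)
    · exact hmap
    · rw [hσ _ (h.proj_mem a ha), hσ a ha, h.map_proj a ha]
  max_mem := fun c hc => Or.inr (h.max_mem c hc)
  map_max := fun c hc => (hσ c (h.max_mem c hc)).trans (h.map_max c hc)
  lt_inf_map := by
    rintro c hc a (rfl | ha) hca
    · exact hlt c hc hca
    · rw [hσ a ha]
      exact h.lt_inf_map c hc a ha hca

/-- No change of `σ` is needed: as `x ∉ Γ`, the points of `Γ` below `a` are those below `x`, and `x`
lies in the same cones as `a`. -/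
theorem insert_of_lt (hT : IsMeetTree T) (h : IsPartialAut hΓ A σ) {x a : T} (hx : x ∉ A)
    (hpx : hΓ.proj x ∈ A) (ha : a ∈ A) (hxa : x < a) :
    IsPartialAut hΓ (insert x A) σ := by
  have hxΓ : x ∉ Γ := fun hx' => hx (hΓ.proj_of_mem hx' ▸ hpx)
  have main : ∀ {x a : T}, x ∉ Γ → x ≤ a → hΓ.proj a = hΓ.proj x := by
    intro x a hxΓ hxa
    refine hΓ.proj_eq_proj hxa ?_
    refine (hT.le_total (hΓ.proj_le a) hxa).resolve_right fun h => ?_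
    exact hxΓ (hΓ.isLowerSet h (hΓ.proj_mem a))
  have hσx : σ x ∉ Γ := by
    intro h1
    have h2 := hΓ.le_proj h1 (σ.map_le_iff.2 hxa.le)
    rw [← h.map_proj a ha, σ.map_le_iff] at h2
    exact hxΓ (hΓ.isLowerSet h2 (hΓ.proj_mem a))
  refine h.extend (fun _ _ => rfl) (fun c hc => ?_) (Or.inr hpx) ?_ ?_
  · rcases hT.le_total hxa.le (inf_le_right : c ⊓ a ≤ a) with h1 | h1
    · exact Or.inl (inf_eq_right.2 (h1.trans inf_le_left))
    · have : c ⊓ x = c ⊓ a := le_antisymm (inf_le_inf_left c hxa.le) (le_inf inf_le_left h1)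
      exact Or.inr (this ▸ h.infClosed hc ha)
  · rw [← main hxΓ hxa.le, h.map_proj a ha, main hσx (σ.map_le_iff.2 hxa.le)]
  · intro c hc hcx
    have h1 : c < x ⊓ a := by rwa [inf_eq_left.2 hxa.le]
    have h2 := h.lt_inf_map c hc a ha (hcx.trans hxa)
    have h3 : c < σ a ⊓ σ x := by
      rw [inf_eq_right.2 (σ.map_le_iff.2 hxa.le), ← h.map_max c hc]
      exact σ.map_lt_iff.2 hcx
    exact hT.lt_inf_trans (hT.lt_inf_trans h1 h2) h3

variable [L.IsRelational] [Countable T] [Countable M]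

/-- A point of `Γ` can be added to the domain, with its image in any interval of `Γ` which induces
the corresponding cut in the range. -/
theorem exists_insert_of_mem (hM : IsStrongFraisseLimit L M)
    (hT : IsGenericMeetTreeExpansion L M T) (h : IsPartialAut hΓ A σ) {x l r : T} (hx : x ∈ Γ)
    (hxA : x ∉ A) (hr : r ∈ Γ) (hlr : l < r) (hl' : ∀ a ∈ A, a ∈ Γ → a < x → σ a ≤ l)
    (hr' : ∀ a ∈ A, a ∈ Γ → x < a → r ≤ σ a) :
    ∃ σ' : TreeAut L T, (∀ a ∈ A, σ' a = σ a) ∧ l < σ' x ∧ σ' x < r ∧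
      IsPartialAut hΓ (insert x A) σ' := by
  have hcases : ∀ a ∈ A, (x < hΓ.proj a ∧ x ≤ a ∧ r ≤ σ a) ∨
      (hΓ.proj a < x ∧ a ⊓ x = hΓ.proj a ∧ hΓ.proj (σ a) ≤ l) := by
    intro a ha
    have hpA := h.proj_mem a ha
    rcases hΓ.lt_or_le hx (hΓ.proj_mem a) with h1 | h1
    · exact Or.inl ⟨h1, h1.le.trans (hΓ.proj_le a),
        (hr' _ hpA (hΓ.proj_mem a) h1).trans (σ.map_le_iff.2 (hΓ.proj_le a))⟩
    · have h2 : hΓ.proj a < x := lt_of_le_of_ne h1 fun h => hxA (h ▸ hpA)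
      refine Or.inr ⟨h2, ?_, ?_⟩
      · rw [hΓ.inf_eq_proj_inf a hx, inf_eq_left.2 h1]
      · rw [← h.map_proj a ha]
        exact hl' _ hpA (hΓ.proj_mem a) h2
  -- `σ x` need not lie in `Γ`. It is moved to a point just below `r`, which is in `Γ` because `Γ`
  -- is downwards closed; the cut conditions make this compatible with `σ '' A`.
  obtain ⟨g, hgB, hgE, hg⟩ := exists_relocation hM hT (E := {l, r}) (B := σ '' A) (y := σ x)
    (e := r) (Set.toFinite _) (h.finite.image σ) h.symm.infClosed
    (by
      rintro ⟨a, ha, hax⟩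
      exact hxA (σ.injective hax ▸ ha)) True (by simp)
    (by
      rintro _ ⟨a, ha, rfl⟩
      rcases hcases a ha with ⟨-, h1, h2⟩ | ⟨-, h1, h2⟩
      · exact Or.inl ⟨⟨trivial, h2⟩, σ.map_le_iff.2 h1⟩
      · refine Or.inr ⟨fun h3 => ?_, ?_, ?_⟩
        · exact absurd ((hΓ.le_proj hr h3.2).trans h2) hlr.not_ge
        · rw [← σ.map_inf, h1, hΓ.inf_eq_proj_inf _ hr, h.map_proj a ha,
            inf_eq_left.2 (h2.trans hlr.le)]
        · rw [← σ.map_inf, h1]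
          exact ⟨_, h.proj_mem a ha, rfl⟩)
  simp only [true_and, Set.mem_insert_iff, Set.mem_singleton_iff, not_or, forall_eq_or_imp,
    forall_eq, le_refl, not_true_eq_false, false_imp_iff, and_true, true_imp_iff, hlr.not_ge,
    not_false_eq_true] at hgE hg
  rw [inf_eq_left.2 hlr.le, inf_eq_left] at hg
  have hgΓ : g (σ x) ∈ Γ := hΓ.isLowerSet hg.2 hr
  refine ⟨g.comp σ, fun a ha => hgB _ ⟨a, ha, rfl⟩, lt_of_le_of_ne hg.1 (Ne.symm hgE.1),
    lt_of_le_of_ne hg.2 hgE.2, ?_⟩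
  refine h.extend (fun a ha => hgB _ ⟨a, ha, rfl⟩) (fun a ha => ?_) ?_ ?_ ?_
  · rcases hcases a ha with ⟨-, h1, h2⟩ | ⟨-, h1, h2⟩
    · exact Or.inl (inf_eq_right.2 h1)
    · exact Or.inr (h1 ▸ h.proj_mem a ha)
  · exact Or.inl (hΓ.proj_of_mem hx)
  · rw [hΓ.proj_of_mem hx]
    exact (hΓ.proj_of_mem hgΓ).symm
  · exact fun c hc hcx => absurd (hc.2 hx) hcx.not_ge

/-- A point of `Γ` can be added to the range, with its preimage in any interval of `Γ` which
induces the corresponding cut in the domain. -/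
theorem exists_insert_of_mem_range (hM : IsStrongFraisseLimit L M)
    (hT : IsGenericMeetTreeExpansion L M T) (h : IsPartialAut hΓ A σ) {y l r : T} (hy : y ∈ Γ)
    (hyA : ∀ a ∈ A, σ a ≠ y) (hr : r ∈ Γ) (hlr : l < r)
    (hl' : ∀ a ∈ A, a ∈ Γ → σ a < y → a ≤ l)
    (hr' : ∀ a ∈ A, a ∈ Γ → y < σ a → r ≤ a) :
    ∃ (σ' : TreeAut L T) (x : T), (∀ a ∈ A, σ' a = σ a) ∧ σ' x = y ∧ l < x ∧ x < r ∧
      IsPartialAut hΓ (insert x A) σ' := by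
  obtain ⟨τ, hτ, hl, hr, hP⟩ := h.symm.exists_insert_of_mem hM hT hy
    (by
      rintro ⟨a, ha, hay⟩
      exact hyA a ha hay) hr hlr
    (by
      rintro _ ⟨a, ha, rfl⟩ haΓ hay
      rw [σ.symm_apply_apply]
      exact hl' a ha ((h.map_mem_iff ha).1 haΓ) hay)
    (by
      rintro _ ⟨a, ha, rfl⟩ haΓ hay
      rw [σ.symm_apply_apply]
      exact hr' a ha ((h.map_mem_iff ha).1 haΓ) hay)
  have hτA : ∀ a ∈ A, τ (σ a) = a := fun a ha => by
    rw [hτ _ ⟨a, ha, rfl⟩, σ.symm_apply_apply]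
  have hA : τ '' insert y (σ '' A) = insert (τ y) A := by
    rw [Set.image_insert_eq, Set.image_image]
    congr 1
    exact (Set.image_congr hτA).trans (Set.image_id' A)
  refine ⟨τ.symm, τ y, fun a ha => ?_, τ.symm_apply_apply y, hl, hr, hA ▸ hP.symm⟩
  conv_lhs => rw [← hτA a ha]
  exact τ.symm_apply_apply _

/-- Here `x` branches off from `A` at `m`, so its meets with `A` are determined by `m`. Only the
projection and the cone of the image need care, and only if `m ∈ Γ`. -/
theorem exists_insert_of_leaf (hM : IsStrongFraisseLimit L M)
    (hT : IsGenericMeetTreeExpansion L M T) (h : IsPartialAut hΓ A σ) {x m : T} (hx : x ∉ A)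
    (hpx : hΓ.proj x ∈ A) (hm : m ∈ A) (hmx : m < x) (hle : ∀ a ∈ A, a ⊓ x ≤ m) :
    ∃ σ' : TreeAut L T, (∀ a ∈ A, σ' a = σ a) ∧ IsPartialAut hΓ (insert x A) σ' := by
  have hxΓ : x ∉ Γ := fun hx' => hx (hΓ.proj_of_mem hx' ▸ hpx)
  have hinf : ∀ a ∈ A, a ⊓ x = a ⊓ m := fun a ha =>
    le_antisymm (le_inf inf_le_left (hle a ha)) (inf_le_inf_left a hmx.le)
  have hinfA : ∀ a ∈ A, a ⊓ x ∈ A := fun a ha => hinf a ha ▸ h.infClosed ha hm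
  have hproj : hΓ.proj x = hΓ.proj m := hΓ.proj_eq_proj hmx.le (by
    have := hle _ hpx
    rwa [inf_eq_left.2 (hΓ.proj_le x)] at this)
  have hσx : σ x ∉ σ '' A := by
    rintro ⟨a, ha, hax⟩
    exact hx (σ.injective hax ▸ ha)
  have hσmx : σ m < σ x := σ.map_lt_iff.2 hmx
  by_cases hmΓ : m ∈ Γ
  swap
  · refine ⟨σ, fun _ _ => rfl, h.extend (fun _ _ => rfl) (fun a ha => Or.inr (hinfA a ha))
      (Or.inr hpx) ?_ fun c hc hcx => ?_⟩
    · rw [hproj, h.map_proj m hm]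
      refine (hΓ.proj_eq_proj hσmx.le ?_).symm
      refine (hT.isMeetTree.le_total (hΓ.proj_le _) hσmx.le).resolve_right fun h1 => ?_
      exact hmΓ ((h.map_mem_iff hm).1 (hΓ.isLowerSet h1 (hΓ.proj_mem _)))
    · have h1 := hle c (h.max_mem c hc)
      rw [inf_eq_left.2 hcx.le] at h1
      have h2 : c < m := lt_of_le_of_ne h1 fun h => hmΓ (h ▸ hc.1)
      exact (h.lt_inf_map c hc m hm h2).trans_le (inf_le_inf hmx.le hσmx.le)
  have hpm : hΓ.proj x = m := hproj.trans (hΓ.proj_of_mem hmΓ)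
  have hσmΓ : σ m ∈ Γ := (h.map_mem_iff hm).2 hmΓ
  -- If `m` is the maximum, the image must stay in the cone of `x`. No point of `σ '' A` lies in
  -- that cone, since its preimage would be there too, so the image can be placed just below `x`.
  by_cases hmax : IsGreatest Γ m
  · have hσm := h.map_max m hmax
    have hlt : ∀ a ∈ A, ¬ m < σ a ⊓ x := by
      intro a ha h1
      have h2 : m < a := by
        rw [← σ.map_lt_iff, hσm]
        exact h1.trans_le inf_le_left
      exact (hT.isMeetTree.lt_inf_trans (h.lt_inf_map m hmax a ha h2) h1).not_ge (hle a ha)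
    obtain ⟨g, hgB, hgE, hg⟩ := exists_relocation hM hT (E := {m, x}) (B := σ '' A) (y := σ x)
      (e := x) (Set.toFinite _) (h.finite.image σ) h.symm.infClosed hσx True (by simp)
      (by
        rintro _ ⟨a, ha, rfl⟩
        refine Or.inr ⟨fun h1 => hlt a ha (by rwa [inf_eq_right.2 h1.2]), ?_, ?_⟩
        · rw [← σ.map_inf, hinf a ha, σ.map_inf, hσm]
          refine le_antisymm (inf_le_inf_left _ hmx.le) (le_inf inf_le_left ?_)
          rcases hT.isMeetTree.le_total (inf_le_right : σ a ⊓ x ≤ x) hmx.le with h1 | h1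
          · exact h1
          · exact (eq_or_lt_of_le h1).elim (fun h => h.ge) fun h => absurd h (hlt a ha)
        · rw [← σ.map_inf]
          exact ⟨_, hinfA a ha, rfl⟩)
    simp only [true_and, Set.mem_insert_iff, Set.mem_singleton_iff, not_or, forall_eq_or_imp,
      forall_eq, le_refl, not_true_eq_false, false_imp_iff, and_true, true_imp_iff, hmx.not_ge,
      not_false_eq_true] at hgE hg
    rw [inf_eq_left.2 hmx.le, inf_eq_left] at hg
    have hmg : m < g (σ x) := lt_of_le_of_ne hg.1 (Ne.symm hgE.1)
    have hσ' : ∀ a ∈ A, g.comp σ a = σ a := fun a ha => hgB _ ⟨a, ha, rfl⟩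
    refine ⟨g.comp σ, hσ', h.extend hσ' (fun a ha => Or.inr (hinfA a ha)) (Or.inr hpx) ?_
      fun c hc hcx => ?_⟩
    · rw [hpm, hσ' m hm, hσm]
      exact (hΓ.proj_eq hmΓ hmg.le fun c hc _ => hmax.2 hc).symm
    · rw [hc.unique hmax]
      exact hmg.trans_le (le_inf hg.2 le_rfl)
  -- Otherwise the image must leave `Γ` exactly at `σ m`. It is placed as a new leaf on `σ m`, so
  -- that it meets `d` in `σ m`.
  · obtain ⟨d, hd, hmd⟩ : ∃ d ∈ Γ, σ m < d := by
      by_contra! hcon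
      have hmax' : IsGreatest Γ (σ m) :=
        ⟨hσmΓ, fun d hd => (hΓ.lt_or_le hσmΓ hd).resolve_left (hcon d hd)⟩
      exact hmax (σ.injective (h.map_max _ hmax') ▸ hmax')
    obtain ⟨g, hgB, hgE, hg⟩ := exists_relocation hM hT (E := {σ m, d}) (B := σ '' A) (y := σ x)
      (e := σ m) (Set.toFinite _) (h.finite.image σ) h.symm.infClosed hσx False (by simp)
      (by
        rintro _ ⟨a, ha, rfl⟩
        refine Or.inr ⟨fun h1 => h1.1, ?_, ?_⟩
        · rw [← σ.map_inf, hinf a ha, σ.map_inf]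
        · rw [← σ.map_inf]
          exact ⟨_, hinfA a ha, rfl⟩)
    simp only [false_and, Set.mem_insert_iff, Set.mem_singleton_iff, not_or, forall_eq_or_imp,
      forall_eq, false_imp_iff, true_and, not_false_eq_true, true_imp_iff, inf_idem,
      inf_eq_left, inf_eq_right.2 hmd.le] at hgE hg
    have hσ' : ∀ a ∈ A, g.comp σ a = σ a := fun a ha => hgB _ ⟨a, ha, rfl⟩
    refine ⟨g.comp σ, hσ', h.extend hσ' (fun a ha => Or.inr (hinfA a ha)) (Or.inr hpx) ?_
      fun c hc hcx => ?_⟩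
    · rw [hpm, hσ' m hm]
      refine (hΓ.proj_eq hσmΓ hg.1 fun c hc hcx => ?_).symm
      rcases hΓ.le_total hc hd with h1 | h1
      · exact hg.2 ▸ le_inf h1 hcx
      · exact absurd (hg.2 ▸ le_inf le_rfl (h1.trans hcx) : d ≤ σ m) hmd.not_ge
    · have h1 := hle c (h.max_mem c hc)
      rw [inf_eq_left.2 hcx.le] at h1
      exact absurd (le_antisymm h1 (hc.2 hmΓ) ▸ hc) hmax

/-- A point outside of `Γ` can be added to the domain without adding points of `Γ`. -/
theorem exists_extension_of_proj_mem (hM : IsStrongFraisseLimit L M)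
    (hT : IsGenericMeetTreeExpansion L M T) (h : IsPartialAut hΓ A σ) {x : T}
    (hpx : hΓ.proj x ∈ A) :
    ∃ (A' : Set T) (σ' : TreeAut L T), A ⊆ A' ∧ (∀ a ∈ A, σ' a = σ a) ∧ x ∈ A' ∧
      A' ∩ Γ ⊆ A ∧ IsPartialAut hΓ A' σ' := by
  by_cases hx : x ∈ A
  · exact ⟨A, σ, subset_rfl, fun _ _ => rfl, hx, Set.inter_subset_left, h⟩
  have hxΓ : x ∉ Γ := fun hx' => hx (hΓ.proj_of_mem hx' ▸ hpx)
  -- The largest meet of `x` with `A` is the point where `x` branches off. It is added first if it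
  -- is not in `A` already.
  obtain ⟨_, ⟨a, ha, rfl⟩, hmax⟩ := exists_greatest_of_finite (h.finite.image (· ⊓ x))
    ⟨_, _, hpx, rfl⟩ (by
      rintro _ ⟨a, -, rfl⟩ _ ⟨b, -, rfl⟩
      exact hT.isMeetTree.le_total inf_le_right inf_le_right)
  have hle : ∀ b ∈ A, b ⊓ x ≤ a ⊓ x := fun b hb => hmax _ ⟨b, hb, rfl⟩
  rcases eq_or_lt_of_le (inf_le_right : a ⊓ x ≤ x) with hax | hax
  · have hxa : x < a := lt_of_le_of_ne (inf_eq_right.1 hax) fun h => hx (h ▸ ha)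
    refine ⟨insert x A, σ, Set.subset_insert _ _, fun _ _ => rfl, Set.mem_insert _ _, ?_,
      h.insert_of_lt hT.isMeetTree hx hpx ha hxa⟩
    rintro b ⟨rfl | hb, hbΓ⟩
    · exact absurd hbΓ hxΓ
    · exact hb
  by_cases hm : a ⊓ x ∈ A
  · obtain ⟨σ', hσ', hP⟩ := h.exists_insert_of_leaf hM hT hx hpx hm hax hle
    refine ⟨insert x A, σ', Set.subset_insert _ _, hσ', Set.mem_insert _ _, ?_, hP⟩
    rintro b ⟨rfl | hb, hbΓ⟩
    · exact absurd hbΓ hxΓ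
    · exact hb
  · have hpm : hΓ.proj x = hΓ.proj (a ⊓ x) := hΓ.proj_eq_proj hax.le (by
      have := hle _ hpx
      rwa [inf_eq_left.2 (hΓ.proj_le x)] at this)
    have hmΓ : a ⊓ x ∉ Γ := fun hm' => hm (hΓ.proj_of_mem hm' ▸ hpm ▸ hpx)
    have h' := h.insert_of_lt hT.isMeetTree (x := a ⊓ x) (a := a) hm (hpm ▸ hpx) ha
      (lt_of_le_of_ne inf_le_left fun h1 => hm (by rwa [h1]))
    obtain ⟨σ', hσ', hP⟩ := h'.exists_insert_of_leaf hM hT (x := x)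
      (by
        rintro (h1 | h1)
        · exact hax.ne h1.symm
        · exact hx h1) (Or.inr hpx) (Or.inl rfl) hax (by
        rintro b (rfl | hb)
        · exact inf_le_left
        · exact hle b hb)
    refine ⟨_, σ', (Set.subset_insert _ _).trans (Set.subset_insert _ _),
      fun b hb => hσ' b (Or.inr hb), Set.mem_insert _ _, ?_, hP⟩
    rintro b ⟨rfl | rfl | hb, hbΓ⟩
    · exact absurd hbΓ hxΓ
    · exact absurd hbΓ hmΓ
    · exact hb

end IsPartialAut

/-- `β` fixes `Γ` and, if `Γ` has a maximum, all cones above it. -/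
def FixesCones (Γ : Set T) (β : T → T) : Prop :=
  β '' Γ = Γ ∧ ∀ c, IsGreatest Γ c → ∀ C ∈ cones c, β '' C = C

theorem FixesCones.id (Γ : Set T) : FixesCones Γ (id : T → T) :=
  ⟨Set.image_id _, fun _ _ _ _ => Set.image_id _⟩

theorem FixesCones.comp {Γ : Set T} {β β' : T → T} (h : FixesCones Γ β) (h' : FixesCones Γ β') :
    FixesCones Γ (β ∘ β') :=
  ⟨by rw [Set.image_comp, h'.1, h.1],
    fun c hc C hC => by rw [Set.image_comp, h'.2 c hc C hC, h.2 c hc C hC]⟩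

/-! ### Generic automorphisms -/

/-- The partial automorphism given by `A'` and `σ'` extends the one given by `A` and `σ`. -/
def Extends (A : Set T) (σ : TreeAut L T) (A' : Set T) (σ' : TreeAut L T) : Prop :=
  A ⊆ A' ∧ ∀ a ∈ A, σ' a = σ a

theorem Extends.refl (A : Set T) (σ : TreeAut L T) : Extends A σ A σ :=
  ⟨subset_rfl, fun _ _ => rfl⟩

theorem Extends.trans {A₁ A₂ A₃ : Set T} {σ₁ σ₂ σ₃ : TreeAut L T} (h : Extends A₁ σ₁ A₂ σ₂)
    (h' : Extends A₂ σ₂ A₃ σ₃) : Extends A₁ σ₁ A₃ σ₃ :=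
  ⟨h.1.trans h'.1, fun a ha => (h'.2 a (h.1 ha)).trans (h.2 a ha)⟩

/-- The Rasiowa–Sikorski argument: countably many cofinal requirements can be met along one
increasing sequence. -/
theorem exists_generic_sequence [Countable T]
    (P : Set T → TreeAut L T → Prop) {A₀ : Set T} {σ₀ : TreeAut L T} (h₀ : P A₀ σ₀)
    {ι : Type*} [Countable ι] (Q : ι → Set T → TreeAut L T → Prop)
    (hQ : ∀ i A σ, P A σ → ∃ A' σ', Extends A σ A' σ' ∧ P A' σ' ∧ Q i A' σ') :
    ∃ (A : ℕ → Set T) (σ : ℕ → TreeAut L T), (∀ n, P (A n) (σ n)) ∧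
      (∀ m n, m ≤ n → Extends (A m) (σ m) (A n) (σ n)) ∧ ∀ i, ∃ n, Q i (A n) (σ n) := by
  have : Encodable ι := Encodable.ofCountable ι
  let S := {s : Set T × TreeAut L T // P s.1 s.2}
  let : Preorder S :=
    { le := fun s t => Extends s.1.1 s.1.2 t.1.1 t.1.2
      le_refl := fun s => Extends.refl _ _
      le_trans := fun _ _ _ h h' => h.trans h' }
  let D : ι → Order.Cofinal S := fun i =>
    { carrier := {s | Q i s.1.1 s.1.2}
      isCofinal := fun s => by
        obtain ⟨A', σ', h1, h2, h3⟩ := hQ i _ _ s.2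
        exact ⟨⟨(A', σ'), h2⟩, h3, h1⟩ }
  let s := Order.sequenceOfCofinals (⟨(A₀, σ₀), h₀⟩ : S) D
  exact ⟨fun n => (s n).1.1, fun n => (s n).1.2, fun n => (s n).2,
    fun m n h => Order.sequenceOfCofinals.monotone _ D h,
    fun i => ⟨_, Order.sequenceOfCofinals.encode_mem _ D i⟩⟩

/-- The union of the finite approximations is total by `hdom`, onto by `hran`, and an automorphism
because any finite tuple lies in a single stage. The predicate `P` may carry invariants beyond
`IsPartialAut`. -/
theorem exists_generic_treeAut [L.IsRelational] [Countable T] (hT : IsMeetTree T)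
    {Γ : Set T} (hΓ : IsSemibranch Γ)
    (P : Set T → TreeAut L T → Prop) (hP : ∀ A σ, P A σ → IsPartialAut hΓ A σ)
    {A₀ : Set T} {σ₀ : TreeAut L T} (h₀ : P A₀ σ₀)
    (hdom : ∀ x A σ, P A σ → ∃ A' σ', Extends A σ A' σ' ∧ P A' σ' ∧ x ∈ A')
    (hran : ∀ y A σ, P A σ → ∃ A' σ', Extends A σ A' σ' ∧ P A' σ' ∧ ∃ x ∈ A', σ' x = y)
    (Q : T → Set T → TreeAut L T → Prop)
    (hQ : ∀ w A σ, P A σ → ∃ A' σ', Extends A σ A' σ' ∧ P A' σ' ∧ Q w A' σ') :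
    ∃ β : TreeAut L T, FixesCones Γ β ∧ ∀ w, ∃ A σ, Q w A σ ∧ ∀ a ∈ A, β a = σ a := by
  obtain ⟨A, σ, hPn, hmono, hQn⟩ := exists_generic_sequence P h₀
    (ι := T ⊕ T ⊕ T) (fun i A σ => match i with
      | .inl x => x ∈ A
      | .inr (.inl y) => ∃ x ∈ A, σ x = y
      | .inr (.inr w) => Q w A σ)
    (by
      rintro (x | y | w)
      · exact hdom x
      · exact hran y
      · exact hQ w)
  have hA : ∀ n, IsPartialAut hΓ (A n) (σ n) := fun n => hP _ _ (hPn n)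
  choose k hk using fun x => hQn (.inl x)
  have hval : ∀ n, ∀ a ∈ A n, σ (k a) a = σ n a := by
    intro n a ha
    rcases le_total (k a) n with h | h
    · exact ((hmono _ _ h).2 a (hk a)).symm
    · exact (hmono _ _ h).2 a ha
  have hmem : ∀ {n : ℕ} (x : Fin n → T), ∃ m, ∀ i, x i ∈ A m := fun x =>
    ⟨Finset.univ.sup fun i => k (x i), fun i =>
      (hmono _ _ (Finset.le_sup (f := fun i => k (x i)) (Finset.mem_univ i))).1 (hk (x i))⟩
  have hmem₂ : ∀ a b, ∃ m, a ∈ A m ∧ b ∈ A m := fun a b =>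
    ⟨max (k a) (k b), (hmono _ _ (le_max_left _ _)).1 (hk a),
      (hmono _ _ (le_max_right _ _)).1 (hk b)⟩
  let f : T → T := fun x => σ (k x) x
  have hf : Function.Bijective f := by
    constructor
    · intro a b hab
      obtain ⟨m, ha, hb⟩ := hmem₂ a b
      simp only [f, hval m a ha, hval m b hb] at hab
      exact (σ m).injective hab
    · intro y
      obtain ⟨n, x, hx, hxy⟩ := hQn (.inr (.inl y))
      exact ⟨x, (hval n x hx).trans hxy⟩
  let β : TreeAut L T := TreeAut.ofEquiv (Equiv.ofBijective f hf)
    (by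
      intro a b
      obtain ⟨m, ha, hb⟩ := hmem₂ a b
      change f (a ⊓ b) = f a ⊓ f b
      simp only [f, hval m a ha, hval m b hb, hval m _ ((hA m).infClosed ha hb)]
      exact (σ m).map_inf a b)
    (by
      intro n r x
      obtain ⟨m, hm⟩ := hmem x
      have : f ∘ x = σ m ∘ x := funext fun i => hval m _ (hm i)
      change Structure.RelMap r (f ∘ x) ↔ _
      rw [this]
      exact (σ m).map_rel r x)
  have hβ : ∀ n, ∀ a ∈ A n, β a = σ n a := hval
  have hβΓ : ∀ a, β a ∈ Γ ↔ a ∈ Γ := fun a => by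
    rw [hβ _ a (hk a)]
    exact (hA _).map_mem_iff (hk a)
  refine ⟨β, ⟨?_, fun c hc C hC => ?_⟩, fun w => ?_⟩
  · ext y
    constructor
    · rintro ⟨a, ha, rfl⟩
      exact (hβΓ a).2 ha
    · intro hy
      obtain ⟨x, rfl⟩ := β.surjective y
      exact ⟨x, (hβΓ x).1 hy, rfl⟩
  · obtain ⟨a, ha, rfl⟩ := hC
    have hβc : β c = c := by
      rw [hβ _ c (hk c)]
      exact (hA _).map_max c hc
    have hlt : ∀ b, c < b → c < b ⊓ β b := fun b hb => by
      rw [hβ _ b (hk b)]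
      exact (hA _).lt_inf_map c hc b (hk b) hb
    ext y
    constructor
    · rintro ⟨b, ⟨hb, hab⟩, rfl⟩
      exact ⟨(hlt b hb).trans_le inf_le_right, hT.lt_inf_trans hab (hlt b hb)⟩
    · rintro ⟨hy, hay⟩
      obtain ⟨x, rfl⟩ := β.surjective y
      have hx : c < x := by rwa [← hβc, β.map_lt_iff] at hy
      refine ⟨x, ⟨hx, hT.lt_inf_trans hay ?_⟩, rfl⟩
      rw [inf_comm]
      exact hlt x hx
  · obtain ⟨n, hn⟩ := hQn (.inr (.inr w))
    exact ⟨A n, σ n, hn, hβ n⟩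

/-! ### Extending partial automorphisms within bounds -/

section Inner

variable {Γ : Set T}

theorem IsSemibranch.mem_inner_iff (hΓ : IsSemibranch Γ) {a : T} :
    a ∈ inner Γ ↔ a ∈ Γ ∧ ¬ IsGreatest Γ a := by
  refine ⟨fun h => ⟨h.1, fun h' => ?_⟩, fun h => ⟨h.1, ?_⟩⟩
  · obtain ⟨-, b, hb, hab⟩ := h
    exact (h'.2 hb).not_gt hab
  · by_contra! hcon
    exact h.2 ⟨h.1, fun b hb => (hΓ.lt_or_le h.1 hb).resolve_left (hcon b hb)⟩

theorem map_mem_inner {g : TreeAut L T} (hg : g '' Γ = Γ) {a : T} (ha : a ∈ inner Γ) :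
    g a ∈ inner Γ := by
  obtain ⟨ha, b, hb, hab⟩ := ha
  exact ⟨hg ▸ ⟨a, ha, rfl⟩, g b, hg ▸ ⟨b, hb, rfl⟩, g.map_lt_iff.2 hab⟩

theorem symm_image_eq {g : TreeAut L T} (hg : g '' Γ = Γ) : g.symm '' Γ = Γ := by
  conv_lhs => rw [← hg]
  rw [Set.image_image]
  simp

theorem IsSemibranch.exists_gt_of_finite (hΓ : IsSemibranch Γ) (hne : (inner Γ).Nonempty)
    {p : T → Prop} (hp : ∀ w ∈ inner Γ, ∃ a ∈ inner Γ, w < a ∧ p a) {F : Set T} (hF : F.Finite)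
    (hFΓ : F ⊆ inner Γ) : ∃ c ∈ inner Γ, (∀ a ∈ F, a < c) ∧ p c := by
  obtain ⟨x, hx⟩ := hne
  obtain ⟨m, hm, hle⟩ := exists_greatest_of_finite (hF.insert x) (Set.insert_nonempty x F)
    fun a ha b hb => hΓ.le_total (Set.insert_subset hx hFΓ ha).1 (Set.insert_subset hx hFΓ hb).1
  obtain ⟨c, hc, hmc, hpc⟩ := hp m (Set.insert_subset hx hFΓ hm)
  exact ⟨c, hc, fun a ha => (hle a (Or.inr ha)).trans_lt hmc, hpc⟩

theorem IsSemibranch.exists_lt_of_finite (hΓ : IsSemibranch Γ) (hne : (inner Γ).Nonempty)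
    {p : T → Prop} (hp : ∀ w ∈ inner Γ, ∃ a ∈ inner Γ, a < w ∧ p a) {F : Set T} (hF : F.Finite)
    (hFΓ : F ⊆ inner Γ) : ∃ c ∈ inner Γ, (∀ a ∈ F, c < a) ∧ p c := by
  obtain ⟨x, hx⟩ := hne
  obtain ⟨m, hm, hle⟩ := exists_least_of_finite (hF.insert x) (Set.insert_nonempty x F)
    fun a ha b hb => hΓ.le_total (Set.insert_subset hx hFΓ ha).1 (Set.insert_subset hx hFΓ hb).1
  obtain ⟨c, hc, hmc, hpc⟩ := hp m (Set.insert_subset hx hFΓ hm)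
  exact ⟨c, hc, fun a ha => hmc.trans_le (hle a (Or.inr ha)), hpc⟩

end Inner

namespace IsPartialAut

variable {Γ : Set T} {hΓ : IsSemibranch Γ} {A : Set T} {σ : TreeAut L T}

theorem of_isGreatest (hΓ : IsSemibranch Γ) :
    IsPartialAut hΓ {c | IsGreatest Γ c} (FirstOrder.Language.Equiv.refl (meetTree.sum L) T) where
  finite := Set.Subsingleton.finite fun _ ha _ hb => ha.unique hb
  infClosed := fun a ha b hb => by rwa [← IsGreatest.unique ha hb, inf_idem]
  proj_mem := fun a ha => by rwa [hΓ.proj_of_mem ha.1]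
  map_proj := fun a ha => rfl
  max_mem := fun c hc => hc
  map_max := fun c hc => rfl
  lt_inf_map := fun c hc a ha h => by
    rw [IsGreatest.unique hc ha] at h
    exact absurd h (lt_irrefl _)

theorem map_mem_inner_iff (h : IsPartialAut hΓ A σ) {a : T} (ha : a ∈ A) :
    σ a ∈ inner Γ ↔ a ∈ inner Γ := by
  rw [hΓ.mem_inner_iff, hΓ.mem_inner_iff, h.map_mem_iff ha]
  refine and_congr_right fun _ => not_congr ⟨fun h' => ?_, fun h' => ?_⟩
  · have := h.map_max _ h'
    rwa [σ.injective this] at h'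
  · rwa [h.map_max _ h']

variable [L.IsRelational] [Countable T] [Countable M]

/-- Any point can be added to the domain. Bounds on the part of the range in `inner Γ` can be
preserved. -/
theorem exists_extends_mem (hM : IsStrongFraisseLimit L M)
    (hT : IsGenericMeetTreeExpansion L M T) (h : IsPartialAut hΓ A σ) {lo hi : T}
    (hlo : lo ∈ inner Γ) (hhi : hi ∈ inner Γ) (hlohi : lo < hi)
    (hb : ∀ a ∈ A, a ∈ inner Γ → lo < σ a ∧ σ a < hi) (x : T) :
    ∃ (A' : Set T) (σ' : TreeAut L T), Extends A σ A' σ' ∧ IsPartialAut hΓ A' σ' ∧ x ∈ A' ∧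
      A' ∩ Γ ⊆ insert (hΓ.proj x) A ∧ ∀ a ∈ A', a ∈ inner Γ → lo < σ' a ∧ σ' a < hi := by
  obtain ⟨A₁, σ₁, hext, hP, hx, hAΓ, hb₁⟩ : ∃ (A₁ : Set T) (σ₁ : TreeAut L T),
      Extends A σ A₁ σ₁ ∧ IsPartialAut hΓ A₁ σ₁ ∧ hΓ.proj x ∈ A₁ ∧
      A₁ ∩ Γ ⊆ insert (hΓ.proj x) A ∧ ∀ a ∈ A₁, a ∈ inner Γ → lo < σ₁ a ∧ σ₁ a < hi := by
    by_cases hq : hΓ.proj x ∈ A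
    · exact ⟨A, σ, Extends.refl A σ, h, hq, fun a ha => Or.inr ha.1, hb⟩
    have hqΓ := hΓ.proj_mem x
    generalize hΓ.proj x = q at hq hqΓ
    have hF : ∀ p : T → Prop, {y | ∃ a ∈ A, a ∈ Γ ∧ p a ∧ σ a = y}.Finite := fun p =>
      (h.finite.image σ).subset (by
        rintro _ ⟨a, ha, -, -, rfl⟩
        exact ⟨a, ha, rfl⟩)
    have hFΓ : ∀ p : T → Prop, {y | ∃ a ∈ A, a ∈ Γ ∧ p a ∧ σ a = y} ⊆ Γ := by
      rintro p _ ⟨a, ha, haΓ, -, rfl⟩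
      exact (h.map_mem_iff ha).2 haΓ
    obtain ⟨l, hl, hl'⟩ := exists_greatest_of_finite ((hF (· < q)).insert lo)
      (Set.insert_nonempty _ _) fun a ha b hb => hΓ.le_total
        (Set.insert_subset hlo.1 (hFΓ _) ha) (Set.insert_subset hlo.1 (hFΓ _) hb)
    obtain ⟨r, hr, hr'⟩ := exists_least_of_finite ((hF (q < ·)).insert hi)
      (Set.insert_nonempty _ _) fun a ha b hb => hΓ.le_total
        (Set.insert_subset hhi.1 (hFΓ _) ha) (Set.insert_subset hhi.1 (hFΓ _) hb)
    have hlr : l < r := by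
      rcases hl with rfl | ⟨a, ha, haΓ, haq, rfl⟩ <;> rcases hr with rfl | ⟨b, hbA, hbΓ, hqb, rfl⟩
      · exact hlohi
      -- The bounds say nothing about the maximum of `Γ`, but that point is fixed and lies above
      -- `lo`.
      · by_cases hbi : b ∈ inner Γ
        · exact (hb b hbA hbi).1
        · have hbm : IsGreatest Γ b := by
            by_contra hcon
            exact hbi (hΓ.mem_inner_iff.2 ⟨hbΓ, hcon⟩)
          rw [h.map_max b hbm]
          obtain ⟨-, d, hd, hlod⟩ := hlo
          exact hlod.trans_le (hbm.2 hd)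
      · exact (hb a ha ⟨haΓ, q, hqΓ, haq⟩).2
      · exact σ.map_lt_iff.2 (haq.trans hqb)
    obtain ⟨σ', hσ', hlσ, hσr, hP⟩ := h.exists_insert_of_mem hM hT hqΓ hq
      (Set.insert_subset hhi.1 (hFΓ _) hr) hlr
      (fun a ha haΓ haq => hl' _ (Or.inr ⟨a, ha, haΓ, haq, rfl⟩))
      (fun a ha haΓ haq => hr' _ (Or.inr ⟨a, ha, haΓ, haq, rfl⟩))
    refine ⟨_, σ', ⟨Set.subset_insert _ _, hσ'⟩, hP, Set.mem_insert _ _,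
      Set.inter_subset_left, ?_⟩
    rintro a (rfl | ha) haΓ
    · exact ⟨(hl' _ (Or.inl rfl)).trans_lt hlσ, hσr.trans_le (hr' _ (Or.inl rfl))⟩
    · rw [hσ' a ha]
      exact hb a ha haΓ
  obtain ⟨A', σ', hA', hσ', hxA', hA'Γ, hP'⟩ := hP.exists_extension_of_proj_mem hM hT hx
  refine ⟨A', σ', hext.trans ⟨hA', hσ'⟩, hP', hxA', fun a ha => hAΓ ⟨hA'Γ ha, ha.2⟩,
    fun a ha haΓ => ?_⟩
  have ha₁ := hA'Γ ⟨ha, haΓ.1⟩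
  rw [hσ' a ha₁]
  exact hb₁ a ha₁ haΓ

/-- Any point can be added to the range. Bounds on the part of the domain in `inner Γ` can be
preserved. -/
theorem exists_extends_mem_range (hM : IsStrongFraisseLimit L M)
    (hT : IsGenericMeetTreeExpansion L M T) (h : IsPartialAut hΓ A σ) {lo hi : T}
    (hlo : lo ∈ inner Γ) (hhi : hi ∈ inner Γ) (hlohi : lo < hi)
    (hb : ∀ a ∈ A, a ∈ inner Γ → lo < a ∧ a < hi) (y : T) :
    ∃ (A' : Set T) (σ' : TreeAut L T), Extends A σ A' σ' ∧ IsPartialAut hΓ A' σ' ∧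
      (∃ x ∈ A', σ' x = y) ∧ ∀ a ∈ A', a ∈ inner Γ → lo < a ∧ a < hi := by
  obtain ⟨B, τ, ⟨hAB, hτ⟩, hP, hy, -, hB⟩ := h.symm.exists_extends_mem hM hT hlo hhi hlohi
    (by
      rintro _ ⟨a, ha, rfl⟩ haΓ
      rw [σ.symm_apply_apply]
      exact hb a ha ((h.map_mem_inner_iff ha).1 haΓ)) y
  have hτA : ∀ a ∈ A, τ (σ a) = a := fun a ha => by
    rw [hτ _ ⟨a, ha, rfl⟩, σ.symm_apply_apply]
  refine ⟨τ '' B, τ.symm, ⟨fun a ha => ⟨σ a, hAB ⟨a, ha, rfl⟩, hτA a ha⟩, fun a ha => ?_⟩,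
    hP.symm, ⟨τ y, ⟨y, hy, rfl⟩, τ.symm_apply_apply y⟩, ?_⟩
  · conv_lhs => rw [← hτA a ha]
    exact τ.symm_apply_apply _
  · rintro _ ⟨b, hb, rfl⟩ hbΓ
    exact hB b hb ((hP.map_mem_inner_iff hb).1 hbΓ)

/-- A point of `inner Γ` can be added to the range, with its preimage in any interval of `Γ` which
induces the corresponding cut in the domain. -/
theorem exists_insert_of_mem_inner (hM : IsStrongFraisseLimit L M)
    (hT : IsGenericMeetTreeExpansion L M T) (h : IsPartialAut hΓ A σ) {y l r : T}
    (hy : y ∈ inner Γ) (hr : r ∈ inner Γ) (hlr : l < r)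
    (hcut : ∀ a ∈ A, a ∈ inner Γ → (σ a < y ∧ a ≤ l) ∨ (y < σ a ∧ r ≤ a)) :
    ∃ (σ' : TreeAut L T) (x : T), x ∈ inner Γ ∧ l < x ∧ x < r ∧ σ' x = y ∧
      Extends A σ (insert x A) σ' ∧ IsPartialAut hΓ (insert x A) σ' := by
  have hcases : ∀ a ∈ A, a ∈ Γ → a ∈ inner Γ ∨ IsGreatest Γ a ∧ σ a = a := by
    intro a ha haΓ
    by_cases hm : IsGreatest Γ a
    · exact Or.inr ⟨hm, h.map_max a hm⟩
    · exact Or.inl (hΓ.mem_inner_iff.2 ⟨haΓ, hm⟩)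
  obtain ⟨σ', x, hσ', hx, hlx, hxr, hP⟩ := h.exists_insert_of_mem_range hM hT hy.1
    (by
      rintro a ha rfl
      rcases hcut a ha ((h.map_mem_inner_iff ha).1 hy) with h | h <;>
        exact absurd h.1 (lt_irrefl _)) hr.1 hlr
    (fun a ha haΓ hay => by
      rcases hcases a ha haΓ with h1 | ⟨h1, h2⟩
      · exact (hcut a ha h1).elim And.right fun h => absurd hay h.1.not_gt
      · exact absurd (h1.2 hy.1) (h2 ▸ hay).not_ge)
    (fun a ha haΓ hay => by
      rcases hcases a ha haΓ with h1 | ⟨h1, h2⟩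
      · exact (hcut a ha h1).elim (fun h => absurd hay h.1.not_gt) And.right
      · exact h1.2 hr.1)
  exact ⟨σ', x, ⟨hΓ.isLowerSet hxr.le hr.1, r, hr.1, hxr⟩, hlx, hxr, hx,
    ⟨Set.subset_insert _ _, hσ'⟩, hP⟩

end IsPartialAut

theorem IsSemibranch.exists_isGreatest_of_not_isBranch {Γ : Set T} (hΓ : IsSemibranch Γ)
    (h : ¬ IsBranch Γ) : ∃ c, IsGreatest Γ c := by
  simp only [IsBranch, IsMaxChain, not_and, not_forall] at h
  obtain ⟨S, hS, hΓS, hne⟩ := h hΓ.isChain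
  obtain ⟨x, hx, hxΓ⟩ : ∃ x ∈ S, x ∉ Γ := by
    by_contra! hcon
    exact hne (hΓS.antisymm hcon)
  obtain ⟨c, hc, hmax⟩ := hΓ.exists_isGreatest x
  refine ⟨c, hc.1, fun b hb => hmax ⟨hb, ?_⟩⟩
  exact (hS.total (hΓS hb) hx).resolve_right fun h => hxΓ (hΓ.isLowerSet h hb)

/-! ### Conjugates moving points upwards -/

/-- The points of `inner Γ` moved upwards by `g` are upwards unbounded. -/
def MovesUpAbove (Γ : Set T) (g : T → T) : Prop :=
  ∀ w ∈ inner Γ, ∃ a ∈ inner Γ, w < a ∧ a < g a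

/-- The points of `inner Γ` moved upwards by `g` are downwards unbounded. -/
def MovesUpBelow (Γ : Set T) (g : T → T) : Prop :=
  ∀ w ∈ inner Γ, ∃ a ∈ inner Γ, a < w ∧ a < g a

/-- The pair `(v, u)` is a finite piece of `β` that decides the inequality. -/
theorem lt_conj_of_le {β h : TreeAut L T} {x y u v : T} (hv : v ≤ y) (hu : x < u)
    (huv : β u = h (β v)) : x < conj β h y := by
  refine hu.trans_le ?_
  change u ≤ β.symm (h (β y))
  rw [← β.map_le_iff, β.apply_symm_apply, huv, h.map_le_iff, β.map_le_iff]
  exact hv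

/-- A finite partial automorphism such that, for all extensions `β`, the composition of `β⁻¹ δ β`
and `δ` moves all points between `lo` and `top` upwards. -/
structure IsIncreasingApprox {Γ : Set T} (hΓ : IsSemibranch Γ) (δ : TreeAut L T) (lo top : T)
    (A : Set T) (σ : TreeAut L T) : Prop where
  isPartialAut : IsPartialAut hΓ A σ
  lo_mem : lo ∈ inner Γ
  top_mem : top ∈ inner Γ
  lo_le : lo ≤ top
  top_lt : top < δ top
  bounds : ∀ a ∈ A, a ∈ inner Γ → lo < a ∧ a < δ top
  exists_pair : ∀ w ∈ inner Γ, lo ≤ w → w < top →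
    ∃ v ∈ A, ∃ u ∈ A, v ≤ δ w ∧ w < u ∧ σ u = δ (σ v)

namespace IsIncreasingApprox

variable {Γ : Set T} {hΓ : IsSemibranch Γ} {δ : TreeAut L T} {lo top : T} {A : Set T}
  {σ : TreeAut L T}

theorem pair_mono {w : T} {A' : Set T} {σ' : TreeAut L T} (hext : Extends A σ A' σ')
    (h : ∃ v ∈ A, ∃ u ∈ A, v ≤ δ w ∧ w < u ∧ σ u = δ (σ v)) :
    ∃ v ∈ A', ∃ u ∈ A', v ≤ δ w ∧ w < u ∧ σ' u = δ (σ' v) := by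
  obtain ⟨v, hv, u, hu, h1, h2, h3⟩ := h
  exact ⟨v, hext.1 hv, u, hext.1 hu, h1, h2, by rw [hext.2 u hu, hext.2 v hv, h3]⟩

end IsIncreasingApprox

/-! ### Choice of signs -/

/-- If `α` moves no point above some `w₁` upwards, the unfixed points there move down, hence are
moved up by `α⁻¹`. -/
theorem exists_movesUpAbove {Γ : Set T} (hΓ : IsSemibranch Γ) {α : TreeAut L T}
    (hα : α '' Γ = Γ) (h : UpwardsUnbounded Γ {x | x ∈ inner Γ ∧ α x ≠ x}) :
    ∃ g : TreeAut L T, (g = α ∨ g = α.symm) ∧ MovesUpAbove Γ g := by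
  by_cases h1 : MovesUpAbove Γ α
  · exact ⟨α, Or.inl rfl, h1⟩
  refine ⟨α.symm, Or.inr rfl, fun w hw => ?_⟩
  simp only [MovesUpAbove, not_forall] at h1
  obtain ⟨w₁, hw₁, hcon⟩ := h1
  obtain ⟨m, hm, hwm, hw₁m⟩ : ∃ m ∈ inner Γ, w ≤ m ∧ w₁ ≤ m := by
    rcases hΓ.le_total hw.1 hw₁.1 with h2 | h2
    · exact ⟨w₁, hw₁, h2, le_rfl⟩
    · exact ⟨w, hw, le_rfl, h2⟩
  obtain ⟨y, ⟨hy, hay⟩, hmy⟩ := h m hm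
  refine ⟨y, hy, hwm.trans_lt hmy, ?_⟩
  rw [← α.map_lt_iff, α.apply_symm_apply]
  rcases hΓ.lt_or_le hy.1 (map_mem_inner hα hy).1 with h2 | h2
  · exact absurd ⟨y, hy, hw₁m.trans_lt hmy, h2⟩ hcon
  · exact lt_of_le_of_ne h2 hay

theorem exists_movesUpBelow {Γ : Set T} (hΓ : IsSemibranch Γ) {α : TreeAut L T}
    (hα : α '' Γ = Γ) (h : DownwardsUnbounded Γ {x | x ∈ inner Γ ∧ α x ≠ x}) :
    ∃ g : TreeAut L T, (g = α ∨ g = α.symm) ∧ MovesUpBelow Γ g := by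
  by_cases h1 : MovesUpBelow Γ α
  · exact ⟨α, Or.inl rfl, h1⟩
  refine ⟨α.symm, Or.inr rfl, fun w hw => ?_⟩
  simp only [MovesUpBelow, not_forall] at h1
  obtain ⟨w₁, hw₁, hcon⟩ := h1
  obtain ⟨m, hm, hwm, hw₁m⟩ : ∃ m ∈ inner Γ, m ≤ w ∧ m ≤ w₁ := by
    rcases hΓ.le_total hw.1 hw₁.1 with h2 | h2
    · exact ⟨w, hw, le_rfl, h2⟩
    · exact ⟨w₁, hw₁, h2, le_rfl⟩
  obtain ⟨y, ⟨hy, hay⟩, hmy⟩ := h m hm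
  refine ⟨y, hy, hmy.trans_le hwm, ?_⟩
  rw [← α.map_lt_iff, α.apply_symm_apply]
  rcases hΓ.lt_or_le hy.1 (map_mem_inner hα hy).1 with h2 | h2
  · exact absurd ⟨y, hy, hmy.trans_le hw₁m, h2⟩ hcon
  · exact lt_of_le_of_ne h2 hay

/-! ### Adding pairs `(v, u)` with `σ u = h (σ v)` -/

namespace IsPartialAut

variable {Γ : Set T} {hΓ : IsSemibranch Γ} {A : Set T} {σ : TreeAut L T}
variable [L.IsRelational] [Countable T] [Countable M]

/-- Since `b` and `h b` lie in the same cut of the range, both preimages fit between `p` and `q`.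
Whether `h` moves `b` up, down or not at all affects only the order of `v` and `u`. -/
theorem exists_pair_of_lt_left (hM : IsStrongFraisseLimit L M)
    (hT : IsGenericMeetTreeExpansion L M T) (hP : IsPartialAut hΓ A σ) {h : TreeAut L T}
    (hh : h '' Γ = Γ) {p q b : T} (hq : q ∈ inner Γ) (hpq : p < q)
    (hb : b ∈ inner Γ)
    (hcut : ∀ c ∈ A, c ∈ inner Γ → (σ c < b ∧ σ c < h b ∧ c ≤ p) ∨
      (b < σ c ∧ h b < σ c ∧ q ≤ c)) :
    ∃ (A' : Set T) (σ' : TreeAut L T), Extends A σ A' σ' ∧ IsPartialAut hΓ A' σ' ∧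
      ∃ v ∈ A', ∃ u ∈ A', v ≤ q ∧ p < u ∧ σ' u = h (σ' v) := by
  obtain ⟨σ₁, v, hv, hpv, hvq, hvb, hext, hP₁⟩ := hP.exists_insert_of_mem_inner hM hT hb hq hpq
    fun c hc hcΓ => (hcut c hc hcΓ).imp (fun h => ⟨h.1, h.2.2⟩) fun h => ⟨h.1, h.2.2⟩
  have hhb := map_mem_inner hh hb
  rcases hΓ.lt_or_le hb.1 hhb.1 with h1 | h1
  · obtain ⟨σ₂, u, hu, hvu, huq, hub, hext₂, hP₂⟩ := hP₁.exists_insert_of_mem_inner hM hT hhb hq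
      hvq (by
        rintro c (rfl | hc) hcΓ
        · exact Or.inl ⟨hvb ▸ h1, le_rfl⟩
        · rw [hext.2 c hc]
          exact (hcut c hc hcΓ).imp (fun h => ⟨h.2.1, h.2.2.trans hpv.le⟩) And.right)
    refine ⟨_, σ₂, hext.trans hext₂, hP₂, v, Or.inr (Or.inl rfl), u, Or.inl rfl, hvq.le,
      hpv.trans hvu, ?_⟩
    rw [hub, hext₂.2 v (Or.inl rfl), hvb]
  rcases eq_or_lt_of_le h1 with h1 | h1
  · refine ⟨_, σ₁, hext, hP₁, v, Or.inl rfl, v, Or.inl rfl, hvq.le, hpv, ?_⟩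
    rw [hvb, h1]
  · obtain ⟨σ₂, u, hu, hpu, huv, hub, hext₂, hP₂⟩ := hP₁.exists_insert_of_mem_inner hM hT hhb hv
      hpv (by
        rintro c (rfl | hc) hcΓ
        · exact Or.inr ⟨hvb ▸ h1, le_rfl⟩
        · rw [hext.2 c hc]
          exact (hcut c hc hcΓ).imp And.right fun h => ⟨h.2.1, hvq.le.trans h.2.2⟩)
    refine ⟨_, σ₂, hext.trans hext₂, hP₂, v, Or.inr (Or.inl rfl), u, Or.inl rfl, hvq.le,
      hpu, ?_⟩
    rw [hub, hext₂.2 v (Or.inl rfl), hvb]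

/-- Here `v` and `u` go into prescribed disjoint intervals, which requires `b < h b`. -/
theorem exists_pair_of_lt_right (hM : IsStrongFraisseLimit L M)
    (hT : IsGenericMeetTreeExpansion L M T) (hP : IsPartialAut hΓ A σ) {h : TreeAut L T}
    (hh : h '' Γ = Γ) {l r l' r' b : T} (hr : r ∈ inner Γ) (hr' : r' ∈ inner Γ)
    (hlr : l < r) (hlr' : l' < r') (hrl' : r ≤ l') (hb : b ∈ inner Γ) (hbh : b < h b)
    (hcut : ∀ c ∈ A, c ∈ inner Γ → (σ c < b ∧ c ≤ l) ∨ (h b < σ c ∧ r' ≤ c)) :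
    ∃ (A' : Set T) (σ' : TreeAut L T) (v u : T), Extends A σ A' σ' ∧ IsPartialAut hΓ A' σ' ∧
      v ∈ A' ∧ u ∈ A' ∧ l < v ∧ v < r ∧ l' < u ∧ u < r' ∧ σ' u = h (σ' v) ∧
      A' = insert u (insert v A) := by
  obtain ⟨σ₁, v, hv, hlv, hvr, hvb, hext, hP₁⟩ := hP.exists_insert_of_mem_inner hM hT hb hr hlr
    fun c hc hcΓ => (hcut c hc hcΓ).imp id fun h => ⟨hbh.trans h.1, hrl'.trans (hlr'.le.trans h.2)⟩
  obtain ⟨σ₂, u, hu, hlu, hur, hub, hext₂, hP₂⟩ := hP₁.exists_insert_of_mem_inner hM hT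
    (map_mem_inner hh hb) hr' hlr' (by
      rintro c (rfl | hc) hcΓ
      · exact Or.inl ⟨hvb ▸ hbh, hvr.le.trans hrl'⟩
      · rw [hext.2 c hc]
        exact (hcut c hc hcΓ).imp
          (fun h => ⟨h.1.trans hbh, h.2.trans (hlr.le.trans hrl')⟩) id)
  refine ⟨_, σ₂, v, u, hext.trans hext₂, hP₂, Or.inr (Or.inl rfl), Or.inl rfl, hlv, hvr, hlu,
    hur, ?_, rfl⟩
  rw [hub, hext₂.2 v (Or.inl rfl), hvb]

end IsPartialAut

/-! ### A product of two conjugates moving points upwards in both directions -/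

variable [L.IsRelational] [Countable T] [Countable M]

theorem exists_conj_comp_movesUp (hM : IsStrongFraisseLimit L M)
    (hT : IsGenericMeetTreeExpansion L M T) {Γ : Set T} (hΓ : IsSemibranch Γ)
    (hne : (inner Γ).Nonempty)
    (hup : ∀ w ∈ inner Γ, ∃ a ∈ inner Γ, w < a ∧ True)
    (hdown : ∀ w ∈ inner Γ, ∃ a ∈ inner Γ, a < w ∧ True) {g h : TreeAut L T}
    (hgΓ : g '' Γ = Γ) (hhΓ : h '' Γ = Γ) (hg : MovesUpAbove Γ g) (hh : MovesUpBelow Γ h) :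
    ∃ β : TreeAut L T, FixesCones Γ β ∧ MovesUpAbove Γ ((conj β h).comp g) ∧
      MovesUpBelow Γ ((conj β h).comp g) := by
  let R : T → Set T → TreeAut L T → Prop := fun x A σ =>
    ∃ v ∈ A, ∃ u ∈ A, v ≤ g x ∧ x < u ∧ σ u = h (σ v)
  have hR : ∀ x A σ A' σ', R x A σ → Extends A σ A' σ' → R x A' σ' := by
    rintro x A σ A' σ' ⟨v, hv, u, hu, h1, h2, h3⟩ hext
    exact ⟨v, hext.1 hv, u, hext.1 hu, h1, h2, by rw [hext.2 u hu, hext.2 v hv, h3]⟩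
  have hfin : ∀ A (σ : TreeAut L T), IsPartialAut hΓ A σ → (A ∩ inner Γ).Finite ∧ A ∩ inner Γ ⊆ inner Γ ∧
      (σ '' (A ∩ inner Γ)).Finite ∧ σ '' (A ∩ inner Γ) ⊆ inner Γ := fun A σ hP =>
    ⟨hP.finite.inter_of_left _, Set.inter_subset_right, (hP.finite.inter_of_left _).image σ, by
      rintro _ ⟨a, ha, rfl⟩
      exact (hP.map_mem_inner_iff ha.1).2 ha.2⟩
  have hpair : ∀ {x y : T}, x ∈ inner Γ → y ∈ inner Γ → ({x, y} : Set T) ⊆ inner Γ :=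
    fun hx hy => Set.insert_subset hx (Set.singleton_subset_iff.2 hy)
  -- High up, `g` supplies an interval `(a, g a)` above the domain. Both `v` and `u` go there, with
  -- images above the range.
  have topStep : ∀ w ∈ inner Γ, ∀ A σ, IsPartialAut hΓ A σ → ∃ A' σ', Extends A σ A' σ' ∧
      IsPartialAut hΓ A' σ' ∧ ∃ x ∈ inner Γ, w < x ∧ R x A' σ' := by
    intro w hw A σ hP
    obtain ⟨h1, h2, h3, h4⟩ := hfin A σ hP
    obtain ⟨a, ha, hAa, haa⟩ := hΓ.exists_gt_of_finite hne hg (h1.insert w)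
      (Set.insert_subset hw h2)
    obtain ⟨d, hd, hAd, -⟩ := hΓ.exists_gt_of_finite hne hup h3 h4
    obtain ⟨b, hb, hdb, -⟩ := hΓ.exists_gt_of_finite hne hup (Set.toFinite {d, h.symm d})
      (hpair hd (map_mem_inner (symm_image_eq hhΓ) hd))
    have hdb₁ := hdb d (by simp)
    have hdb₂ := hdb (h.symm d) (by simp)
    rw [← h.map_lt_iff, h.apply_symm_apply] at hdb₂
    obtain ⟨A', σ', hext, hP', v, hv, u, hu, h5, h6, h7⟩ := hP.exists_pair_of_lt_left hM hT hhΓ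
      (map_mem_inner hgΓ ha) haa hb fun c hc hcΓ => by
        have := hAd _ ⟨c, ⟨hc, hcΓ⟩, rfl⟩
        exact Or.inl ⟨this.trans hdb₁, this.trans hdb₂, (hAa c (Or.inr ⟨hc, hcΓ⟩)).le⟩
    exact ⟨A', σ', hext, hP', a, ha, hAa w (Or.inl rfl), v, hv, u, hu, h5, h6, h7⟩
  -- Far down, `h` supplies `b < h b` below the range. Now `g x` may be below `x`, but `v` is put
  -- below `g x` and `u` above `x`.
  have botStep : ∀ w ∈ inner Γ, ∀ A σ, IsPartialAut hΓ A σ → ∃ A' σ', Extends A σ A' σ' ∧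
      IsPartialAut hΓ A' σ' ∧ ∃ x ∈ inner Γ, x < w ∧ R x A' σ' := by
    intro w hw A σ hP
    obtain ⟨h1, h2, h3, h4⟩ := hfin A σ hP
    obtain ⟨r, hr, hrA, -⟩ := hΓ.exists_lt_of_finite hne hdown (h1.insert w)
      (Set.insert_subset hw h2)
    obtain ⟨q, hq, hqr, -⟩ := hdown r hr
    obtain ⟨x, hx, hxq, -⟩ := hΓ.exists_lt_of_finite hne hdown (Set.toFinite {q, g.symm q})
      (hpair hq (map_mem_inner (symm_image_eq hgΓ) hq))
    have hxq₁ := hxq q (by simp)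
    have hxq₂ := hxq (g.symm q) (by simp)
    rw [← g.map_lt_iff, g.apply_symm_apply] at hxq₂
    obtain ⟨p, hp, hpx, -⟩ := hdown (g x) (map_mem_inner hgΓ hx)
    obtain ⟨d, hd, hdA, -⟩ := hΓ.exists_lt_of_finite hne hdown h3 h4
    obtain ⟨b, hb, hbd, hbb⟩ := hh (h.symm d) (map_mem_inner (symm_image_eq hhΓ) hd)
    rw [← h.map_lt_iff, h.apply_symm_apply] at hbd
    obtain ⟨A', σ', v, u, hext, hP', hv, hu, -, h6, h7, -, h9, -⟩ :=
      hP.exists_pair_of_lt_right hM hT hhΓ (map_mem_inner hgΓ hx) hr hpx hqr hxq₂.le hb hbb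
        fun c hc hcΓ => Or.inr ⟨hbd.trans (hdA _ ⟨c, ⟨hc, hcΓ⟩, rfl⟩),
          (hrA c (Or.inr ⟨hc, hcΓ⟩)).le⟩
    exact ⟨A', σ', hext, hP', x, hx, hxq₁.trans (hqr.trans (hrA w (Or.inl rfl))), v, hv, u, hu,
      h6.le, hxq₁.trans h7, h9⟩
  obtain ⟨β, hβ, hQ⟩ := exists_generic_treeAut hT.isMeetTree hΓ (IsPartialAut hΓ)
    (fun _ _ h => h) (IsPartialAut.of_isGreatest (L := L) hΓ)
    (fun x A σ hP => by
      obtain ⟨-, -, h3, h4⟩ := hfin A σ hP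
      obtain ⟨lo, hlo, hloA, -⟩ := hΓ.exists_lt_of_finite hne hdown h3 h4
      obtain ⟨hi, hhi, hAhi, -⟩ := hΓ.exists_gt_of_finite hne hup (h3.insert lo)
        (Set.insert_subset hlo h4)
      obtain ⟨A', σ', h5, h6, h7, -⟩ := hP.exists_extends_mem hM hT hlo hhi
        (hAhi lo (Or.inl rfl)) (fun a ha haΓ => ⟨hloA _ ⟨a, ⟨ha, haΓ⟩, rfl⟩,
          hAhi _ (Or.inr ⟨a, ⟨ha, haΓ⟩, rfl⟩)⟩) x
      exact ⟨A', σ', h5, h6, h7⟩)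
    (fun y A σ hP => by
      obtain ⟨h1, h2, -, -⟩ := hfin A σ hP
      obtain ⟨lo, hlo, hloA, -⟩ := hΓ.exists_lt_of_finite hne hdown h1 h2
      obtain ⟨hi, hhi, hAhi, -⟩ := hΓ.exists_gt_of_finite hne hup (h1.insert lo)
        (Set.insert_subset hlo h2)
      obtain ⟨A', σ', h5, h6, h7, -⟩ := hP.exists_extends_mem_range hM hT hlo hhi
        (hAhi lo (Or.inl rfl)) (fun a ha haΓ => ⟨hloA _ ⟨ha, haΓ⟩,
          hAhi _ (Or.inr ⟨ha, haΓ⟩)⟩) y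
      exact ⟨A', σ', h5, h6, h7⟩)
    (fun w A σ => w ∈ inner Γ → (∃ x ∈ inner Γ, w < x ∧ R x A σ) ∧
      ∃ x ∈ inner Γ, x < w ∧ R x A σ)
    (fun w A σ hP => by
      by_cases hw : w ∈ inner Γ
      · obtain ⟨A₁, σ₁, hext₁, hP₁, x, hx, hwx, hxR⟩ := topStep w hw A σ hP
        obtain ⟨A₂, σ₂, hext₂, hP₂, h2⟩ := botStep w hw A₁ σ₁ hP₁
        exact ⟨A₂, σ₂, hext₁.trans hext₂, hP₂,
          fun _ => ⟨⟨x, hx, hwx, hR _ _ _ _ _ hxR hext₂⟩, h2⟩⟩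
      · exact ⟨A, σ, Extends.refl A σ, hP, fun h => absurd h hw⟩)
  have hlt : ∀ x A σ, R x A σ → (∀ a ∈ A, β a = σ a) → x < (conj β h).comp g x := by
    rintro x A σ ⟨v, hv, u, hu, h1, h2, h3⟩ hβσ
    exact lt_conj_of_le h1 h2 (by rw [hβσ u hu, hβσ v hv, h3])
  refine ⟨β, hβ, fun w hw => ?_, fun w hw => ?_⟩
  · obtain ⟨A, σ, hQw, hβσ⟩ := hQ w
    obtain ⟨⟨x, hx, hwx, hxR⟩, -⟩ := hQw hw
    exact ⟨x, hx, hwx, hlt x A σ hxR hβσ⟩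
  · obtain ⟨A, σ, hQw, hβσ⟩ := hQ w
    obtain ⟨-, x, hx, hwx, hxR⟩ := hQw hw
    exact ⟨x, hx, hwx, hlt x A σ hxR hβσ⟩

/-! ### From unbounded upward moves to a strictly increasing product -/

namespace IsIncreasingApprox

variable {Γ : Set T} {hΓ : IsSemibranch Γ} {δ : TreeAut L T} {lo top : T} {A : Set T}
  {σ : TreeAut L T}

/-- One pair with `top < v < δ top` and `top' < u < δ top'` serves all `w` in `[top, top')`, because
`v < δ top ≤ δ w` and `w < top' < u`. -/
theorem extend_up (hM : IsStrongFraisseLimit L M) (hT : IsGenericMeetTreeExpansion L M T)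
    (hδ : δ '' Γ = Γ) (hup : MovesUpAbove Γ δ) (h : IsIncreasingApprox hΓ δ lo top A σ) {w : T}
    (hw : w ∈ inner Γ) :
    ∃ A' σ' top', Extends A σ A' σ' ∧ IsIncreasingApprox hΓ δ lo top' A' σ' ∧ w < top' := by
  have hP := h.isPartialAut
  have hne : (inner Γ).Nonempty := ⟨w, hw⟩
  have hδtop := map_mem_inner hδ h.top_mem
  obtain ⟨l, hl, hlA⟩ := exists_greatest_of_finite
    ((hP.finite.inter_of_left (inner Γ)).insert top) (Set.insert_nonempty _ _)
    fun a ha b hb => hΓ.le_total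
      (Set.insert_subset h.top_mem Set.inter_subset_right ha).1
      (Set.insert_subset h.top_mem Set.inter_subset_right hb).1
  have hltop : l < δ top := by
    rcases hl with rfl | ⟨hl, hl'⟩
    · exact h.top_lt
    · exact (h.bounds l hl hl').2
  obtain ⟨b, hb, hAb, hbb⟩ := hΓ.exists_gt_of_finite hne hup
    ((hP.finite.inter_of_left (inner Γ)).image σ) (by
      rintro _ ⟨a, ha, rfl⟩
      exact (hP.map_mem_inner_iff ha.1).2 ha.2)
  obtain ⟨top', htop', hlt, hδtop'⟩ := hΓ.exists_gt_of_finite hne hup (Set.toFinite {w, δ top})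
    (Set.insert_subset hw (Set.singleton_subset_iff.2 hδtop))
  have hw' := hlt w (by simp)
  have ht' := hlt (δ top) (by simp)
  obtain ⟨A', σ', v, u, hext, hP', hv, hu, hlv, hvr, hlu, hur, huv, hA'⟩ :=
    hP.exists_pair_of_lt_right hM hT hδ hδtop (map_mem_inner hδ htop') hltop hδtop' ht'.le hb hbb
      fun c hc hcΓ => Or.inl ⟨hAb _ ⟨c, ⟨hc, hcΓ⟩, rfl⟩, hlA c (Or.inr ⟨hc, hcΓ⟩)⟩
  have htv : top < v := (hlA top (Or.inl rfl)).trans_lt hlv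
  refine ⟨A', σ', top', hext, ⟨hP', h.lo_mem, htop', h.lo_le.trans (h.top_lt.trans ht').le,
    hδtop', ?_, fun x hx hlx hxt => ?_⟩, hw'⟩
  · have ht'' : δ top < δ top' := ht'.trans hδtop'
    rw [hA']
    rintro a (rfl | rfl | ha) haΓ
    · exact ⟨h.lo_le.trans_lt (htv.trans (hvr.trans (ht'.trans hlu))), hur⟩
    · exact ⟨h.lo_le.trans_lt htv, hvr.trans ht''⟩
    · exact ⟨(h.bounds a ha haΓ).1, (h.bounds a ha haΓ).2.trans ht''⟩
  · rcases hΓ.lt_or_le hx.1 h.top_mem.1 with h1 | h1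
    · exact pair_mono hext (h.exists_pair x hx hlx h1)
    · exact ⟨v, hv, u, hu, hvr.le.trans (δ.map_le_iff.2 h1), hxt.trans hlu, huv⟩

/-- With `a < v < δ a < lo < u`, one pair serves all `w` in `[a, lo)`, because `v < δ a ≤ δ w` and
`w < lo < u`. -/
theorem extend_down (hM : IsStrongFraisseLimit L M) (hT : IsGenericMeetTreeExpansion L M T)
    (hδ : δ '' Γ = Γ) (hdown : MovesUpBelow Γ δ) (h : IsIncreasingApprox hΓ δ lo top A σ) {w : T}
    (hw : w ∈ inner Γ) :
    ∃ A' σ' lo', Extends A σ A' σ' ∧ IsIncreasingApprox hΓ δ lo' top A' σ' ∧ lo' < w := by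
  have hP := h.isPartialAut
  have hne : (inner Γ).Nonempty := ⟨w, hw⟩
  have hδtop := map_mem_inner hδ h.top_mem
  have hlo' := map_mem_inner (symm_image_eq hδ) h.lo_mem
  obtain ⟨r, hr, hrA⟩ := exists_least_of_finite
    ((hP.finite.inter_of_left (inner Γ)).insert (δ top)) (Set.insert_nonempty _ _)
    fun a ha b hb => hΓ.le_total
      (Set.insert_subset hδtop Set.inter_subset_right ha).1
      (Set.insert_subset hδtop Set.inter_subset_right hb).1
  have hrΓ : r ∈ inner Γ := Set.insert_subset hδtop Set.inter_subset_right hr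
  have hlor : lo < r := by
    rcases hr with rfl | ⟨hr, hr'⟩
    · exact h.lo_le.trans_lt h.top_lt
    · exact (h.bounds r hr hr').1
  obtain ⟨d, hd, hdA, -⟩ := hΓ.exists_lt_of_finite hne hdown
    ((hP.finite.inter_of_left (inner Γ)).image σ) (by
      rintro _ ⟨a, ha, rfl⟩
      exact (hP.map_mem_inner_iff ha.1).2 ha.2)
  obtain ⟨b, hb, hbd, hbb⟩ := hdown (δ.symm d) (map_mem_inner (symm_image_eq hδ) hd)
  rw [← δ.map_lt_iff, δ.apply_symm_apply] at hbd
  obtain ⟨a, ha, hlt, haa⟩ := hΓ.exists_lt_of_finite hne hdown (Set.toFinite {w, δ.symm lo})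
    (Set.insert_subset hw (Set.singleton_subset_iff.2 hlo'))
  have haw := hlt w (by simp)
  have halo := hlt (δ.symm lo) (by simp)
  rw [← δ.map_lt_iff, δ.apply_symm_apply] at halo
  obtain ⟨A', σ', v, u, hext, hP', hv, hu, hlv, hvr, hlu, hur, huv, hA'⟩ :=
    hP.exists_pair_of_lt_right hM hT hδ (map_mem_inner hδ ha) hrΓ haa hlor halo.le hb hbb
      fun c hc hcΓ => Or.inr ⟨hbd.trans (hdA _ ⟨c, ⟨hc, hcΓ⟩, rfl⟩), hrA c (Or.inr ⟨hc, hcΓ⟩)⟩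
  have hrtop : r ≤ δ top := hrA _ (Or.inl rfl)
  refine ⟨A', σ', a, hext, ⟨hP', ha, h.top_mem, (haa.trans halo).le.trans h.lo_le,
    h.top_lt, ?_, fun x hx hlx hxt => ?_⟩, haw⟩
  · rw [hA']
    rintro c (rfl | rfl | hc) hcΓ
    · exact ⟨haa.trans (halo.trans hlu), hur.trans_le hrtop⟩
    · exact ⟨hlv, hvr.trans (halo.trans (hlor.trans_le hrtop))⟩
    · exact ⟨haa.trans (halo.trans (h.bounds c hc hcΓ).1), (h.bounds c hc hcΓ).2⟩
  · rcases hΓ.lt_or_le hx.1 h.lo_mem.1 with h1 | h1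
    · exact ⟨v, hv, u, hu, hvr.le.trans (δ.map_le_iff.2 hlx), h1.trans hlu, huv⟩
    · exact pair_mono hext (h.exists_pair x hx h1 hxt)

theorem extend_both (hM : IsStrongFraisseLimit L M) (hT : IsGenericMeetTreeExpansion L M T)
    (hδ : δ '' Γ = Γ) (hup : MovesUpAbove Γ δ) (hdown : MovesUpBelow Γ δ)
    (h : IsIncreasingApprox hΓ δ lo top A σ) {w : T} (hw : w ∈ inner Γ) :
    ∃ A' σ' lo' top', Extends A σ A' σ' ∧ IsIncreasingApprox hΓ δ lo' top' A' σ' ∧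
      lo' < w ∧ w < top' := by
  obtain ⟨A₁, σ₁, top', hext₁, h₁, hwt⟩ := h.extend_up hM hT hδ hup hw
  obtain ⟨A₂, σ₂, lo', hext₂, h₂, hlw⟩ := h₁.extend_down hM hT hδ hdown hw
  exact ⟨A₂, σ₂, lo', top', hext₁.trans hext₂, h₂, hlw, hwt⟩

end IsIncreasingApprox

theorem exists_conj_comp_increasing (hM : IsStrongFraisseLimit L M)
    (hT : IsGenericMeetTreeExpansion L M T) {Γ : Set T} (hΓ : IsSemibranch Γ)
    (hne : (inner Γ).Nonempty) {δ : TreeAut L T} (hδ : δ '' Γ = Γ) (hup : MovesUpAbove Γ δ)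
    (hdown : MovesUpBelow Γ δ) :
    ∃ β : TreeAut L T, FixesCones Γ β ∧ IsStrictlyIncreasing Γ ((conj β δ).comp δ) := by
  obtain ⟨x₀, hx₀⟩ := hne
  obtain ⟨a₀, ha₀, -, haa₀⟩ := hup x₀ hx₀
  obtain ⟨β, hβ, hQ⟩ := exists_generic_treeAut hT.isMeetTree hΓ
    (fun A σ => ∃ lo top, IsIncreasingApprox hΓ δ lo top A σ)
    (by
      rintro A σ ⟨lo, top, h⟩
      exact h.isPartialAut)
    ⟨a₀, a₀, IsPartialAut.of_isGreatest (L := L) hΓ, ha₀, ha₀, le_rfl, haa₀,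
      fun a ha haΓ => absurd ha (hΓ.mem_inner_iff.1 haΓ).2,
      fun w _ h1 h2 => absurd h2 h1.not_gt⟩
    (by
      rintro x A σ ⟨lo, top, h⟩
      -- The interval is widened past the projection of `x` first, so that adding `x` respects the
      -- bounds on the domain.
      obtain ⟨A₁, σ₁, lo₁, top₁, hext₁, h₁, hx⟩ : ∃ A₁ σ₁ lo₁ top₁, Extends A σ A₁ σ₁ ∧
          IsIncreasingApprox hΓ δ lo₁ top₁ A₁ σ₁ ∧
          (hΓ.proj x ∈ inner Γ → lo₁ < hΓ.proj x ∧ hΓ.proj x < top₁) := by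
        by_cases hx : hΓ.proj x ∈ inner Γ
        · obtain ⟨A₁, σ₁, lo₁, top₁, h1, h2, h3⟩ := h.extend_both hM hT hδ hup hdown hx
          exact ⟨A₁, σ₁, lo₁, top₁, h1, h2, fun _ => h3⟩
        · exact ⟨A, σ, lo, top, Extends.refl A σ, h, fun h => absurd h hx⟩
      have hP := h₁.isPartialAut
      have hF := (hP.finite.inter_of_left (inner Γ)).image σ₁
      have hFΓ : σ₁ '' (A₁ ∩ inner Γ) ⊆ inner Γ := by
        rintro _ ⟨a, ha, rfl⟩
        exact (hP.map_mem_inner_iff ha.1).2 ha.2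
      obtain ⟨lo', hlo', hlo, -⟩ := hΓ.exists_lt_of_finite ⟨x₀, hx₀⟩ hdown hF hFΓ
      obtain ⟨hi', hhi', hhi, -⟩ := hΓ.exists_gt_of_finite ⟨x₀, hx₀⟩ hup (hF.insert lo')
        (Set.insert_subset hlo' hFΓ)
      obtain ⟨A₂, σ₂, hext₂, hP₂, hxA, hAΓ, -⟩ := hP.exists_extends_mem hM hT hlo' hhi'
        (hhi lo' (Or.inl rfl)) (fun a ha haΓ => ⟨hlo _ ⟨a, ⟨ha, haΓ⟩, rfl⟩,
          hhi _ (Or.inr ⟨a, ⟨ha, haΓ⟩, rfl⟩)⟩) x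
      refine ⟨A₂, σ₂, hext₁.trans hext₂, ⟨lo₁, top₁, hP₂, h₁.lo_mem, h₁.top_mem, h₁.lo_le,
        h₁.top_lt, fun a ha haΓ => ?_, fun w hw h1 h2 =>
          IsIncreasingApprox.pair_mono hext₂ (h₁.exists_pair w hw h1 h2)⟩, hxA⟩
      rcases hAΓ ⟨ha, haΓ.1⟩ with rfl | ha'
      · exact ⟨(hx haΓ).1, (hx haΓ).2.trans h₁.top_lt⟩
      · exact h₁.bounds a ha' haΓ)
    (by
      rintro y A σ ⟨lo, top, h⟩
      obtain ⟨A₂, σ₂, hext₂, hP₂, hy, hb⟩ := h.isPartialAut.exists_extends_mem_range hM hT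
        h.lo_mem (map_mem_inner hδ h.top_mem) (h.lo_le.trans_lt h.top_lt) h.bounds y
      exact ⟨A₂, σ₂, hext₂, ⟨lo, top, hP₂, h.lo_mem, h.top_mem, h.lo_le, h.top_lt, hb,
        fun w hw h1 h2 => IsIncreasingApprox.pair_mono hext₂ (h.exists_pair w hw h1 h2)⟩, hy⟩)
    (fun w A σ => w ∈ inner Γ → ∃ v ∈ A, ∃ u ∈ A, v ≤ δ w ∧ w < u ∧ σ u = δ (σ v))
    (by
      rintro w A σ ⟨lo, top, h⟩
      by_cases hw : w ∈ inner Γ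
      · obtain ⟨A₁, σ₁, lo₁, top₁, h1, h2, h3, h4⟩ := h.extend_both hM hT hδ hup hdown hw
        exact ⟨A₁, σ₁, h1, ⟨lo₁, top₁, h2⟩, fun _ => h2.exists_pair w hw h3.le h4⟩
      · exact ⟨A, σ, Extends.refl A σ, ⟨lo, top, h⟩, fun h => absurd h hw⟩)
  refine ⟨β, hβ, fun w hw => ?_⟩
  obtain ⟨A, σ, hQw, hβσ⟩ := hQ w
  obtain ⟨v, hv, u, hu, h1, h2, h3⟩ := hQw hw
  exact lt_conj_of_le h1 h2 (by rw [hβσ u hu, hβσ v hv, h3])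

end MeetTreeExpansion

/-! ### The corollary -/

open MeetTreeExpansion in
theorem corollaryc {L : FirstOrder.Language.{u, v}} [L.IsRelational]
    [Finite (Σ n, L.Relations n)]
    {M : Type w} [L.Structure M] [Countable M] [Infinite M]
    (hM : MeetTreeExpansion.IsStrongFraisseLimit L M)
    {T : Type w} [SemilatticeInf T] [L.Structure T] [Countable T]
    (hT : MeetTreeExpansion.IsGenericMeetTreeExpansion L M T)
    (Γ : Set T) (hΓ : MeetTreeExpansion.IsSemibranch Γ)
    (α : MeetTreeExpansion.TreeAut L T) (hα : α '' Γ = Γ)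
    (hunb : MeetTreeExpansion.IsUnbounded Γ α) :
    ∃ α' β : Fin 4 → MeetTreeExpansion.TreeAut L T,
      (∀ i, α' i = α ∨ α' i = α.symm) ∧
      (∀ i, β i '' Γ = Γ) ∧
      MeetTreeExpansion.IsStrictlyIncreasing Γ
        ((MeetTreeExpansion.conj (β 0) (α' 0)).comp
          ((MeetTreeExpansion.conj (β 1) (α' 1)).comp
            ((MeetTreeExpansion.conj (β 2) (α' 2)).comp
              (MeetTreeExpansion.conj (β 3) (α' 3))))) ∧
      (¬ MeetTreeExpansion.IsBranch Γ →
        ∃ γ, IsGreatest Γ γ ∧ ∀ i, ∀ C ∈ MeetTreeExpansion.cones γ, β i '' C = C) := by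
  obtain ⟨α', β, h1, h2, h3⟩ : ∃ α' β : Fin 4 → TreeAut L T,
      (∀ i, α' i = α ∨ α' i = α.symm) ∧ (∀ i, FixesCones Γ (β i)) ∧
      IsStrictlyIncreasing Γ ((conj (β 0) (α' 0)).comp ((conj (β 1) (α' 1)).comp
        ((conj (β 2) (α' 2)).comp (conj (β 3) (α' 3))))) := by
    have hid : FixesCones Γ (FirstOrder.Language.Equiv.refl (meetTree.sum L) T) :=
      FixesCones.id Γ
    rcases (inner Γ).eq_empty_or_nonempty with hempty | hne
    · exact ⟨fun _ => α, fun _ => FirstOrder.Language.Equiv.refl _ T, fun _ => Or.inl rfl,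
        fun _ => hid, fun x hx => absurd hx (hempty ▸ Set.notMem_empty x)⟩
    obtain ⟨g, hgα, hg⟩ := exists_movesUpAbove hΓ hα hunb.1
    obtain ⟨h, hhα, hh⟩ := exists_movesUpBelow hΓ hα hunb.2
    have hΓ' : ∀ f : TreeAut L T, (f = α ∨ f = α.symm) → f '' Γ = Γ := by
      rintro f (rfl | rfl)
      · exact hα
      · exact symm_image_eq hα
    obtain ⟨β₁, hβ₁, hup, hdown⟩ := exists_conj_comp_movesUp hM hT hΓ hne
      (fun w hw => (hg w hw).imp fun a ha => ⟨ha.1, ha.2.1, trivial⟩)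
      (fun w hw => (hh w hw).imp fun a ha => ⟨ha.1, ha.2.1, trivial⟩)
      (hΓ' g hgα) (hΓ' h hhα) hg hh
    have hδ : ((conj β₁ h).comp g) '' Γ = Γ := by
      change (β₁.symm ∘ h ∘ β₁ ∘ g) '' Γ = Γ
      rw [Set.image_comp, Set.image_comp, Set.image_comp, hΓ' g hgα, hβ₁.1, hΓ' h hhα,
        symm_image_eq hβ₁.1]
    obtain ⟨β₂, hβ₂, hinc⟩ := exists_conj_comp_increasing hM hT hΓ hne hδ hup hdown
    -- With `δ = (β₁⁻¹ h β₁) g`, the product `(β₂⁻¹ δ β₂) δ` equals `((β₁β₂)⁻¹ h (β₁β₂)) (β₂⁻¹ g β₂)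
    -- (β₁⁻¹ h β₁) g`.
    refine ⟨![h, g, h, g], ![β₁.comp β₂, β₂, β₁, FirstOrder.Language.Equiv.refl _ T], ?_, ?_, ?_⟩
    · intro i
      fin_cases i
      exacts [hhα, hgα, hhα, hgα]
    · intro i
      fin_cases i
      exacts [hβ₁.comp hβ₂, hβ₂, hβ₁, hid]
    · intro x hx
      refine (hinc x hx).trans_eq ?_
      change β₂.symm (β₁.symm (h (β₁ (g (β₂ _))))) =
        β₂.symm (β₁.symm (h (β₁ (β₂ (β₂.symm (g (β₂ _)))))))
      rw [β₂.apply_symm_apply]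
      rfl
  refine ⟨α', β, h1, fun i => (h2 i).1, h3, fun hb => ?_⟩
  obtain ⟨c, hc⟩ := hΓ.exists_isGreatest_of_not_isBranch hb
  exact ⟨c, hc, fun i => (h2 i).2 c hc⟩
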